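/- Let $s\in(0,\tfrac12)$. For disjoint measurable sets $S_1,S_2\subset\mathbb{R}^2$ put $$I(S_1,S_2):=\iint_{S_1\times S_2}\frac{dx\,dy}{|x-y|^{2+2s}}\in[0,\infty],$$ and for measurable $E\subset\mathbb{R}^2$ and an open set $\Omega\subset\mathbb{R}^2$ define the $s$-perimeter of $E$ in $\Omega$ by $$\mathrm{Per}_s(E,\Omega):=I(E\cap\Omega,E^c\cap\Omega)+I(E\cap\Omega,E^c\setminus\Omega)+I(E\setminus\Omega,E^c\cap\Omega).$$ A measurable set $E$ is a minimizer for the $s$-perimeter in $\Omega$ if $\mathrm{Per}_s(E,\Omega)\le\mathrm{Per}_s(F,\Omega)$ for every measurable $F\subset\mathbb{R}^2$ with $F\setminus\Omega=E\setminus\Omega$. Let $B_r$ denote the open ball of radius $r$ centered at the origin. Then there is a constant $C>0$, depending only on $s$, such that for every $R\ge2$ and every minimizer $E\subset\mathbb{R}^2$ for the $s$-perimeter in $B_R$ there exists a halfplane $h\subset\mathbb{R}^2$ with $$\big|(E\,\Delta\,h)\cap B_1\big|\le\frac{C}{R^s},$$ where $E\,\Delta\,h=(E\setminus h)\cup(h\setminus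 E)$ and $|\cdot|$ is the Lebesgue measure. -/

import Mathlib

open MeasureTheory

noncomputable section

/-- The interaction `I(S₁, S₂) = ∬_{S₁ × S₂} |x - y|^{-(n + 2s)} dx dy` of two disjoint subsets
of `ℝⁿ`, with values in `[0, ∞]`. -/
def sInteraction {n : ℕ} (s : ℝ) (S₁ S₂ : Set (EuclideanSpace ℝ (Fin n))) : ENNReal :=
  ∫⁻ p in S₁ ×ˢ S₂, ENNReal.ofReal (1 / ‖p.1 - p.2‖ ^ ((n : ℝ) + 2 * s))

/-- The `s`-perimeter of `E` in `Ω`. The interaction of `E \ Ω` with `Eᶜ \ Ω` is omitted. -/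
def sPerimeter {n : ℕ} (s : ℝ) (E Ω : Set (EuclideanSpace ℝ (Fin n))) : ENNReal :=
  sInteraction s (E ∩ Ω) (Eᶜ ∩ Ω) + sInteraction s (E ∩ Ω) (Eᶜ \ Ω)
    + sInteraction s (E \ Ω) (Eᶜ ∩ Ω)

/-- `E` minimizes the `s`-perimeter in `Ω`: it is Lebesgue measurable, and its `s`-perimeter in
`Ω` is at most that of every Lebesgue measurable set that agrees with `E` outside `Ω`.
(`NullMeasurableSet` for the Borel measure `volume` is Lebesgue measurability.) -/
structure IsSMinimizer {n : ℕ} (s : ℝ) (E Ω : Set (EuclideanSpace ℝ (Fin n))) : Prop where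
  nullMeasurableSet : NullMeasurableSet E volume
  le : ∀ F : Set (EuclideanSpace ℝ (Fin n)), NullMeasurableSet F volume → F \ Ω = E \ Ω →
    sPerimeter s E Ω ≤ sPerimeter s F Ω

/-- A closed halfspace of `ℝⁿ` (a halfplane when `n = 2`), with unit exterior normal `ν`. -/
def IsHalfspace {n : ℕ} (h : Set (EuclideanSpace ℝ (Fin n))) : Prop :=
  ∃ (ν : EuclideanSpace ℝ (Fin n)) (c : ℝ), ‖ν‖ = 1 ∧ h = {x | inner ℝ ν x ≤ c}

end

/-! Inside a large ball a minimizer can be translated near the origin at almost no cost, and this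
makes it almost monotone in every direction. Take a cutoff `φ` equal to 1 on `B_{R/2}`, zero off
`B_R`, with slope `O(1/R)`, and let `F`, `F'` be the images of `E` under `x ↦ x ± φ x • w`.
First-order terms cancel in `Per F + Per F'`, so this sum exceeds `2 Per E` by at most `O(R⁻²) Per
E` (`sPerimeter_deform_add_le`). Comparison with `E \ B_R` gives `Per E ≤ C R^(2-2s)`, so the excess
is `O(R^(-2s))`. Submodularity holds with the defect `I(E \ F, F \ E)` restricted to a small ball
(`sPerimeter_union_add_inter_le`); minimality against `E ∪ F`, `E ∩ F` and `F'` bounds this defect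
by the excess. Near the origin the kernel is bounded below and `F` is a translate of `E`, so the
product of the masses gained and lost by translating is `O(R^(-2s))`, and one of them is at most `η
= C / R^s` (`exists_crossing_bound`).

What remains is measure theory for a set whose bounded translations are all one-sided up to `η`. By
continuity along a circle of directions, some translation of length 4 has both masses at most `η`
(`exists_almost_invariant_direction`). Along that direction the set is almost invariant, hence close
to a function of the other coordinate alone (`exists_close_slice`). On the line, one-sided
translations force closeness to a half-line (`exists_halfline`). Each reduction costs only a
numerical factor. -/

theorem intervalIntegrable_of_measurable_of_bounded {g : ℝ → ℝ} (hg : Measurable g) (C : ℝ)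
    (hC : ∀ x, |g x| ≤ C) (a b : ℝ) : IntervalIntegrable g volume a b :=
  (intervalIntegrable_const (c := C)).mono_fun hg.aestronglyMeasurable
    (Filter.Eventually.of_forall fun x => by
      simpa [Real.norm_eq_abs] using (hC x).trans (le_abs_self C))

/-! ### Binary functions on the line: mass entering and leaving under translation. -/

section Line

variable {f : ℝ → ℝ}

theorem intervalIntegrable_binary (hf : Measurable f) (h01 : ∀ x, f x = 0 ∨ f x = 1) (a b : ℝ) :
    IntervalIntegrable f volume a b :=
  intervalIntegrable_of_measurable_of_bounded hf 1
    (fun x => by rcases h01 x with h | h <;> simp [h]) a b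

theorem intervalIntegrable_leaving (hf : Measurable f) (h01 : ∀ x, f x = 0 ∨ f x = 1)
    (t a b : ℝ) : IntervalIntegrable (fun y => f y * (1 - f (y - t))) volume a b :=
  intervalIntegrable_of_measurable_of_bounded (by fun_prop) 1
    (fun x => by rcases h01 x with h | h <;> rcases h01 (x - t) with h' | h' <;> simp [h, h']) a b

theorem intervalIntegrable_entering (hf : Measurable f) (h01 : ∀ x, f x = 0 ∨ f x = 1)
    (t a b : ℝ) : IntervalIntegrable (fun y => (1 - f y) * f (y - t)) volume a b :=
  intervalIntegrable_of_measurable_of_bounded (by fun_prop) 1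
    (fun x => by rcases h01 x with h | h <;> rcases h01 (x - t) with h' | h' <;> simp [h, h']) a b

theorem leaving_nonneg {α : Type*} {f : α → ℝ} (h01 : ∀ x, f x = 0 ∨ f x = 1) (y z : α) : 0 ≤ f y * (1 - f z) := by
  rcases h01 y with h | h <;> rcases h01 z with h' | h' <;> simp [h, h']

theorem entering_nonneg {α : Type*} {f : α → ℝ} (h01 : ∀ x, f x = 0 ∨ f x = 1) (y z : α) : 0 ≤ (1 - f y) * f z := by
  rcases h01 y with h | h <;> rcases h01 z with h' | h' <;> simp [h, h']

theorem intervalIntegrable_shift (hf : Measurable f) (h01 : ∀ x, f x = 0 ∨ f x = 1)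
    (t a b : ℝ) : IntervalIntegrable (fun y => f (y - t)) volume a b :=
  intervalIntegrable_of_measurable_of_bounded (by fun_prop) 1
    (fun x => by rcases h01 (x - t) with h' | h' <;> simp [h']) a b

/-- Pointwise `(1 - u) v - u (1 - v) = v - u`. The net gain thus depends only on masses of
intervals, so it varies continuously with `t` and its zeros can be found by the intermediate value
theorem. -/
theorem entering_sub_leaving (hf : Measurable f) (h01 : ∀ x, f x = 0 ∨ f x = 1) (t a b : ℝ) :
    (∫ y in a..b, (1 - f y) * f (y - t)) - ∫ y in a..b, f y * (1 - f (y - t))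
      = (∫ y in (a - t)..(b - t), f y) - ∫ y in a..b, f y := by
  rw [← intervalIntegral.integral_comp_sub_right (fun y => f y) t,
    ← intervalIntegral.integral_sub (intervalIntegrable_entering hf h01 t a b)
      (intervalIntegrable_leaving hf h01 t a b),
    ← intervalIntegral.integral_sub (intervalIntegrable_shift hf h01 t a b)
      (intervalIntegrable_binary hf h01 a b)]
  congr 1; ext y; ring

theorem entering_add_leaving (hf : Measurable f) (h01 : ∀ x, f x = 0 ∨ f x = 1) (t a b : ℝ) :
    (∫ y in a..b, |f y - f (y - t)|) =
    (∫ y in a..b, (1 - f y) * f (y - t)) + ∫ y in a..b, f y * (1 - f (y - t)) := by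
  rw [← intervalIntegral.integral_add (intervalIntegrable_entering hf h01 t a b)
      (intervalIntegrable_leaving hf h01 t a b)]
  congr 1; ext y
  rcases h01 y with h | h <;> rcases h01 (y - t) with h' | h' <;> simp [h, h']

theorem intervalIntegrable_abs_diff (hf : Measurable f) (h01 : ∀ x, f x = 0 ∨ f x = 1)
    (t a b : ℝ) : IntervalIntegrable (fun y => |f y - f (y - t)|) volume a b :=
  intervalIntegrable_of_measurable_of_bounded (by fun_prop) 1
    (fun x => by rcases h01 x with h | h <;> rcases h01 (x - t) with h' | h' <;> simp [h, h']) a b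

/-- If `f` is almost `t`-periodic, windows of length at most `t` placed a multiple of `t` apart
carry almost the same mass. -/
theorem abs_window_sub_window_le (hf : Measurable f) (h01 : ∀ x, f x = 0 ∨ f x = 1) {s t : ℝ}
    (hs : 0 ≤ s) (hst : s ≤ t) (a : ℝ) (N : ℕ) :
    |(∫ y in (a + N * t - s)..(a + N * t), f y) - ∫ y in (a - s)..a, f y| ≤
      ∫ y in a..(a + N * t), |f y - f (y - t)| := by
  induction N with
  | zero => simp
  | succ N ih =>
    set x := a + N * t with hx
    have e : a + ((N + 1 : ℕ) : ℝ) * t = x + t := by rw [hx]; push_cast; ring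
    rw [e, ← intervalIntegral.integral_add_adjacent_intervals
      (intervalIntegrable_abs_diff hf h01 t a x) (intervalIntegrable_abs_diff hf h01 t x (x + t))]
    have h1 : (∫ y in (x + t - s)..(x + t), f y) - ∫ y in (x - s)..x, f y
        = ∫ y in (x + t - s)..(x + t), (f y - f (y - t)) := by
      rw [intervalIntegral.integral_sub (intervalIntegrable_binary hf h01 _ _)
        (intervalIntegrable_shift hf h01 t _ _),
        intervalIntegral.integral_comp_sub_right (fun y => f y) t]
      congr 2 <;> ring
    -- Because `s ≤ t`, the new window lies in the new period `[x, x + t]`; the increments are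
    -- therefore charged to disjoint intervals and telescope.
    have h2 : |∫ y in (x + t - s)..(x + t), (f y - f (y - t))| ≤
        ∫ y in x..(x + t), |f y - f (y - t)| := by
      refine (intervalIntegral.abs_integral_le_integral_abs (by linarith)).trans ?_
      exact intervalIntegral.integral_mono_interval (by linarith) (by linarith) le_rfl
        (Filter.Eventually.of_forall fun y => abs_nonneg _)
        (intervalIntegrable_abs_diff hf h01 t _ _)
    have h3 := abs_sub_le (∫ y in (x + t - s)..(x + t), f y) (∫ y in (x - s)..x, f y)
      (∫ y in (a - s)..a, f y)
    rw [h1] at h3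
    linarith

/-- A translation under which `f` keeps its mass leaves `f` almost unchanged, and so do all
shorter translations. -/
theorem crossings_le_of_period (hf : Measurable f) (h01 : ∀ x, f x = 0 ∨ f x = 1) {η : ℝ}
    (h : ∀ t ∈ Set.Icc (0 : ℝ) 2, (∫ y in (-3)..1, f y * (1 - f (y - t))) ≤ η ∨
      (∫ y in (-3)..1, (1 - f y) * f (y - t)) ≤ η) {t : ℝ} (ht : t ∈ Set.Icc (0 : ℝ) 2)
    (hz : (∫ y in (-3 - t)..(1 - t), f y) - ∫ y in (-3)..1, f y = 0) {s : ℝ} (hs : 0 ≤ s)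
    (hst : s ≤ t) :
    (∫ y in (-1)..1, f y * (1 - f (y - s))) ≤ 3 * η ∧
      (∫ y in (-1)..1, (1 - f y) * f (y - s)) ≤ 3 * η := by
  have hη : 0 ≤ η := by
    rcases h t ht with h | h
    · exact (intervalIntegral.integral_nonneg (by norm_num)
        fun y _ => leaving_nonneg h01 y (y - t)).trans h
    · exact (intervalIntegral.integral_nonneg (by norm_num)
        fun y _ => entering_nonneg h01 y (y - t)).trans h
  rcases ht.1.eq_or_lt with h0 | h0
  · obtain rfl : s = 0 := by linarith
    have : ∀ y, f y * (1 - f y) = 0 := fun y => by rcases h01 y with h | h <;> simp [h]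
    simp [this, mul_comm (1 - f _), hη]
  -- Zero net gain makes the entering and leaving masses equal, so the bound known for one holds for
  -- both.
  have hper : ∫ y in (-3)..1, |f y - f (y - t)| ≤ 2 * η := by
    rw [entering_add_leaving hf h01]
    rw [← entering_sub_leaving hf h01] at hz
    rcases h t ht with h | h <;> linarith
  -- With `N * t` in `[2, 4]` the point `a = 1 - N * t` lies in `[-3, -1]`, so `[a, 1]` sits between
  -- `[-1, 1]` and `[-3, 1]`.
  obtain ⟨N, hN1, hN2⟩ : ∃ N : ℕ, 2 ≤ N * t ∧ N * t ≤ 4 := by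
    refine ⟨⌈2 / t⌉₊, ?_, ?_⟩
    · have := Nat.le_ceil (2 / t)
      rwa [div_le_iff₀ h0] at this
    · have := Nat.ceil_lt_add_one (a := 2 / t) (by positivity)
      have h2 : (⌈2 / t⌉₊ : ℝ) * t ≤ (2 / t + 1) * t := by gcongr
      have h3 : (2 / t + 1) * t = 2 + t := by field_simp
      linarith [ht.2]
  set a := 1 - N * t with ha
  have hw := abs_window_sub_window_le hf h01 hs hst a N
  have e1 : a + N * t = 1 := by rw [ha]; ring
  rw [e1] at hw
  have hw2 : (∫ y in a..1, |f y - f (y - t)|) ≤ 2 * η :=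
    (intervalIntegral.integral_mono_interval (by linarith) (by linarith) le_rfl
        (Filter.Eventually.of_forall fun y => abs_nonneg _)
        (intervalIntegrable_abs_diff hf h01 t _ _)).trans hper
  -- On `[a, 1]` the net gain of the shift by `s` is the mass of the window ending at `a` minus that
  -- of the window ending at `1`, at most `2 * η` in absolute value. One crossing mass is at most
  -- `η`, hence the other is at most `3 * η`.
  have hd := entering_sub_leaving hf h01 s a 1
  have i := intervalIntegrable_binary hf h01
  have e2 := intervalIntegral.integral_add_adjacent_intervals (i (a - s) a) (i a (1 - s))
  have e3 := intervalIntegral.integral_add_adjacent_intervals (i a (1 - s)) (i (1 - s) 1)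
  have hdd := abs_le.1 (hw.trans hw2)
  have hs2 : s ∈ Set.Icc (0 : ℝ) 2 := ⟨hs, hst.trans ht.2⟩
  have m1 : (∫ y in (-1)..1, f y * (1 - f (y - s))) ≤ ∫ y in a..1, f y * (1 - f (y - s)) :=
    intervalIntegral.integral_mono_interval (by linarith) (by linarith) le_rfl
        (Filter.Eventually.of_forall fun y => leaving_nonneg h01 _ _)
        (intervalIntegrable_leaving hf h01 s _ _)
  have m2 : (∫ y in (-1)..1, (1 - f y) * f (y - s)) ≤ ∫ y in a..1, (1 - f y) * f (y - s) :=
    intervalIntegral.integral_mono_interval (by linarith) (by linarith) le_rfl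
        (Filter.Eventually.of_forall fun y => entering_nonneg h01 _ _)
        (intervalIntegrable_entering hf h01 s _ _)
  have m3 : (∫ y in a..1, f y * (1 - f (y - s))) ≤ ∫ y in (-3)..1, f y * (1 - f (y - s)) :=
    intervalIntegral.integral_mono_interval (by linarith) (by linarith) le_rfl
        (Filter.Eventually.of_forall fun y => leaving_nonneg h01 _ _)
        (intervalIntegrable_leaving hf h01 s _ _)
  have m4 : (∫ y in a..1, (1 - f y) * f (y - s)) ≤ ∫ y in (-3)..1, (1 - f y) * f (y - s) :=
    intervalIntegral.integral_mono_interval (by linarith) (by linarith) le_rfl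
        (Filter.Eventually.of_forall fun y => entering_nonneg h01 _ _)
        (intervalIntegrable_entering hf h01 s _ _)
  rcases h s hs2 with h | h <;> constructor <;> linarith

/-- If for each translation one of the two crossing masses is small, then it is the same one for
all translations. -/
theorem crossings_one_sided (hf : Measurable f) (h01 : ∀ x, f x = 0 ∨ f x = 1) {η : ℝ}
    (h : ∀ t ∈ Set.Icc (0 : ℝ) 2, (∫ y in (-3)..1, f y * (1 - f (y - t))) ≤ η ∨
      (∫ y in (-3)..1, (1 - f y) * f (y - t)) ≤ η) :
    (∀ t ∈ Set.Icc (0 : ℝ) 2, (∫ y in (-1)..1, f y * (1 - f (y - t))) ≤ 3 * η) ∨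
    (∀ t ∈ Set.Icc (0 : ℝ) 2, (∫ y in (-1)..1, (1 - f y) * f (y - t)) ≤ 3 * η) := by
  set F : ℝ → ℝ := fun t => (∫ y in (-3 - t)..(1 - t), f y) - ∫ y in (-3)..1, f y with hF
  have i := intervalIntegrable_binary hf h01
  have hFc : Continuous F := by
    have hp := intervalIntegral.continuous_primitive i 0
    have : F = fun t => ((∫ y in (0)..(1 - t), f y) - ∫ y in (0)..(-3 - t), f y)
        - ∫ y in (-3)..1, f y := by
      ext t
      rw [hF, intervalIntegral.integral_interval_sub_left (i _ _) (i _ _)]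
    rw [this]
    exact ((hp.comp (by fun_prop : Continuous fun t : ℝ => 1 - t)).sub
      (hp.comp (by fun_prop : Continuous fun t : ℝ => -3 - t))).sub continuous_const
  -- `T` is the last zero of the net gain `F`. Up to `T` both crossing masses are small, `T` acting
  -- as an almost period; beyond `T` the sign of `F` is that of `F 2`, so the same crossing mass is
  -- always the smaller one.
  obtain ⟨T, ⟨hT, hT0⟩, hTmax⟩ :=
    ((isCompact_Icc (a := (0 : ℝ)) (b := 2)).inter_right
      (isClosed_singleton.preimage hFc : IsClosed (F ⁻¹' {0}))).exists_isGreatest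
      ⟨0, by simp, by simp [hF]⟩
  have small := fun s (hs : 0 ≤ s) (hsT : s ≤ T) =>
    crossings_le_of_period hf h01 h hT hT0 hs hsT
  have hη : 0 ≤ η := by
    rcases h T hT with h | h
    · exact (intervalIntegral.integral_nonneg (by norm_num)
        fun y _ => leaving_nonneg h01 y (y - T)).trans h
    · exact (intervalIntegral.integral_nonneg (by norm_num)
        fun y _ => entering_nonneg h01 y (y - T)).trans h
  have hne : ∀ t ∈ Set.Icc (0 : ℝ) 2, T < t → F t ≠ 0 := fun t ht hTt h0 =>
    absurd (hTmax ⟨ht, h0⟩) (not_le.2 hTt)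
  have m1 : ∀ s, (∫ y in (-1)..1, f y * (1 - f (y - s))) ≤ ∫ y in (-3)..1, f y * (1 - f (y - s)) :=
    fun s => intervalIntegral.integral_mono_interval (by norm_num) (by norm_num) le_rfl
        (Filter.Eventually.of_forall fun y => leaving_nonneg h01 _ _)
        (intervalIntegrable_leaving hf h01 s _ _)
  have m2 : ∀ s, (∫ y in (-1)..1, (1 - f y) * f (y - s)) ≤ ∫ y in (-3)..1, (1 - f y) * f (y - s) :=
    fun s => intervalIntegral.integral_mono_interval (by norm_num) (by norm_num) le_rfl
        (Filter.Eventually.of_forall fun y => entering_nonneg h01 _ _)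
        (intervalIntegrable_entering hf h01 s _ _)
  rcases le_total 0 (F 2) with h2 | h2
  · left
    intro t ht
    rcases le_or_gt t T with htT | htT
    · exact (small t ht.1 htT).1
    have hpos : 0 ≤ F t := by
      by_contra hneg
      obtain ⟨u, hu, hu0⟩ := intermediate_value_Icc ht.2 hFc.continuousOn
        (⟨(not_le.1 hneg).le, h2⟩ : (0 : ℝ) ∈ Set.Icc (F t) (F 2))
      exact hne u ⟨ht.1.trans hu.1, hu.2⟩ (htT.trans_le hu.1) hu0
    have hd := entering_sub_leaving hf h01 t (-3) 1
    have : F t = _ := rfl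
    have := m1 t
    rcases h t ht with h | h <;> linarith
  · right
    intro t ht
    rcases le_or_gt t T with htT | htT
    · exact (small t ht.1 htT).2
    have hpos : F t ≤ 0 := by
      by_contra hneg
      obtain ⟨u, hu, hu0⟩ := intermediate_value_Icc' ht.2 hFc.continuousOn
        (⟨h2, (not_le.1 hneg).le⟩ : (0 : ℝ) ∈ Set.Icc (F 2) (F t))
      exact hne u ⟨ht.1.trans hu.1, hu.2⟩ (htT.trans_le hu.1) hu0
    have hd := entering_sub_leaving hf h01 t (-3) 1
    have : F t = _ := rfl
    have := m2 t
    rcases h t ht with h | h <;> linarith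

end Line

/-! ### Binary functions on the line: closeness to a half-line. -/

section Line

variable {f : ℝ → ℝ}

theorem integrableOn_of_bounded {α : Type*} [MeasurableSpace α] {μ : Measure α} {g : α → ℝ}
    (hg : Measurable g) (C : ℝ) (hC : ∀ x, |g x| ≤ C) {S : Set α} (hS : μ S ≠ ⊤) :
    IntegrableOn g S μ :=
  Measure.integrableOn_of_bounded hS hg.aestronglyMeasurable
    (Filter.Eventually.of_forall fun x => by simpa [Real.norm_eq_abs] using hC x)

theorem volume_uIoc_prod_ne_top (a b c d : ℝ) :
    (volume : Measure (ℝ × ℝ)) (Set.uIoc a b ×ˢ Set.uIoc c d) ≠ ⊤ := by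
  rw [Measure.volume_eq_prod, Measure.prod_prod]
  exact ENNReal.mul_ne_top (by simp [Set.uIoc]) (by simp [Set.uIoc])

/-- The pairs `u < a` with `f u = 0`, `f a = 1`, `a ∈ [α, β]` and `a - u ≤ r` are few. -/
theorem integral_pairs_below_le (hf : Measurable f) (h01 : ∀ x, f x = 0 ∨ f x = 1) {η : ℝ}
    (h : ∀ t ∈ Set.Icc (0 : ℝ) 2, (∫ y in (-1)..1, f y * (1 - f (y - t))) ≤ η)
    {α β r : ℝ} (hα : -1 ≤ α) (hαβ : α ≤ β) (hβ : β ≤ 1) (hr : 0 ≤ r) (hr2 : r ≤ 2) :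
    (∫ a in α..β, f a * ∫ u in (a - r)..a, (1 - f u)) ≤ r * η := by
  -- In the variable `t = a - u`, swapping the integrals leaves for each `t ∈ [0, r]` one crossing
  -- mass, at most `η`.
  have e : ∀ a, f a * (∫ u in (a - r)..a, (1 - f u)) = ∫ t in (0)..r, f a * (1 - f (a - t)) := by
    intro a
    rw [intervalIntegral.integral_const_mul,
      intervalIntegral.integral_comp_sub_left (fun u => 1 - f u) a, sub_zero]
  simp_rw [e]
  rw [intervalIntegral_intervalIntegral_swap]
  · calc (∫ t in (0)..r, ∫ a in α..β, f a * (1 - f (a - t))) ≤ ∫ t in (0)..r, η := by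
          refine intervalIntegral.integral_mono_on hr ?_ (by simp) ?_
          · refine intervalIntegrable_of_measurable_of_bounded ?_ (β - α) ?_ _ _
            · simp_rw [intervalIntegral.integral_of_le hαβ]
              exact (StronglyMeasurable.integral_prod_right'
                (ν := volume.restrict (Set.Ioc α β)) (f := fun p : ℝ × ℝ => f p.2 * (1 - f (p.2 - p.1)))
                (by fun_prop : Measurable _).stronglyMeasurable).measurable
            · intro t
              have := intervalIntegral.norm_integral_le_of_norm_le_const (a := α) (b := β)
                (f := fun a => f a * (1 - f (a - t))) (C := 1) (fun x _ => by
                  rcases h01 x with h | h <;> rcases h01 (x - t) with h' | h' <;> simp [h, h'])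
              rwa [one_mul, abs_of_nonneg (by linarith : 0 ≤ β - α)] at this
          · intro t ht
            exact (intervalIntegral.integral_mono_interval hα hαβ hβ
              (Filter.Eventually.of_forall fun y => leaving_nonneg h01 _ _)
              (intervalIntegrable_leaving hf h01 t _ _)).trans (h t ⟨ht.1, ht.2.trans hr2⟩)
      _ = r * η := by simp
  · refine integrableOn_of_bounded ?_ 1 ?_ (volume_uIoc_prod_ne_top _ _ _ _)
    · exact (by fun_prop : Measurable fun p : ℝ × ℝ => f p.1 * (1 - f (p.1 - p.2)))
    · rintro ⟨x, t⟩
      rcases h01 x with h | h <;> rcases h01 (x - t) with h' | h' <;> simp [Function.uncurry, h, h']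

/-- The pairs `b < u` with `f b = 0`, `f u = 1`, `b ∈ [α, β]` and `u - b ≤ r` are few. -/
theorem integral_pairs_above_le (hf : Measurable f) (h01 : ∀ x, f x = 0 ∨ f x = 1) {η : ℝ}
    (h : ∀ t ∈ Set.Icc (0 : ℝ) 2, (∫ y in (-1)..1, f y * (1 - f (y - t))) ≤ η)
    {α β r : ℝ} (hα : -1 ≤ α) (hαβ : α ≤ β) (hβ : β + r ≤ 1) (hr : 0 ≤ r) :
    (∫ b in α..β, (1 - f b) * ∫ u in b..(b + r), f u) ≤ r * η := by
  have e : ∀ b, (1 - f b) * (∫ u in b..(b + r), f u) = ∫ t in (0)..r, (1 - f b) * f (t + b) := by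
    intro b
    rw [intervalIntegral.integral_const_mul,
      intervalIntegral.integral_comp_add_right (fun u => f u) b, zero_add, add_comm r]
  simp_rw [e]
  rw [intervalIntegral_intervalIntegral_swap]
  · calc (∫ t in (0)..r, ∫ b in α..β, (1 - f b) * f (t + b)) ≤ ∫ t in (0)..r, η := by
          refine intervalIntegral.integral_mono_on hr ?_ (by simp) ?_
          · refine intervalIntegrable_of_measurable_of_bounded ?_ (β - α) ?_ _ _
            · simp_rw [intervalIntegral.integral_of_le hαβ]
              exact (StronglyMeasurable.integral_prod_right'
                (ν := volume.restrict (Set.Ioc α β)) (f := fun p : ℝ × ℝ => (1 - f p.2) * f (p.1 + p.2))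
                (by fun_prop : Measurable _).stronglyMeasurable).measurable
            · intro t
              have := intervalIntegral.norm_integral_le_of_norm_le_const (a := α) (b := β)
                (f := fun b => (1 - f b) * f (t + b)) (C := 1) (fun x _ => by
                  rcases h01 x with h | h <;> rcases h01 (t + x) with h' | h' <;> simp [h, h'])
              rwa [one_mul, abs_of_nonneg (by linarith : 0 ≤ β - α)] at this
          · intro t ht
            have e2 : (∫ b in α..β, (1 - f b) * f (t + b))
                = ∫ y in (α + t)..(β + t), f y * (1 - f (y - t)) := by
              rw [← intervalIntegral.integral_comp_add_right
                (fun y => f y * (1 - f (y - t))) t]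
              congr 1; ext b; rw [add_sub_cancel_right, add_comm b]; ring
            rw [e2]
            exact (intervalIntegral.integral_mono_interval (by linarith [ht.1]) (by linarith)
              (by linarith [ht.2])
              (Filter.Eventually.of_forall fun y => leaving_nonneg h01 _ _)
              (intervalIntegrable_leaving hf h01 t _ _)).trans
                (h t ⟨ht.1, by linarith [ht.2]⟩)
      _ = r * η := by simp
  · refine integrableOn_of_bounded ?_ 1 ?_ (volume_uIoc_prod_ne_top _ _ _ _)
    · exact (by fun_prop : Measurable fun p : ℝ × ℝ => (1 - f p.1) * f (p.2 + p.1))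
    · rintro ⟨x, t⟩
      rcases h01 x with h | h <;> rcases h01 (t + x) with h' | h' <;> simp [Function.uncurry, h, h']

/-- A binary function that is almost nonincreasing, in the sense that every translation to the
right adds little mass to it, is close to the indicator of a left half-line. -/
theorem exists_left_halfline (hf : Measurable f) (h01 : ∀ x, f x = 0 ∨ f x = 1) {η : ℝ}
    (h : ∀ t ∈ Set.Icc (0 : ℝ) 2, (∫ y in (-1)..1, f y * (1 - f (y - t))) ≤ η) :
    ∃ c ∈ Set.Icc (-1 : ℝ) 1, (∫ y in (-1)..c, (1 - f y)) ≤ 32 * η ∧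
      (∫ y in c..1, f y) ≤ 32 * η := by
  have i := intervalIntegrable_binary hf h01
  have h0 : ∀ x, 0 ≤ f x := fun x => by rcases h01 x with h | h <;> simp [h]
  have h1 : ∀ x, 0 ≤ 1 - f x := fun x => by rcases h01 x with h | h <;> simp [h]
  have i' : ∀ a b, IntervalIntegrable (fun x => 1 - f x) volume a b := fun a b =>
    intervalIntegrable_const.sub (i a b)
  have ci : ∀ a b, (∫ y in a..b, (1 - f y)) = b - a - ∫ y in a..b, f y := fun a b => by
    rw [intervalIntegral.integral_sub intervalIntegrable_const (i a b)]; simp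
  have n0 : ∀ a b, a ≤ b → 0 ≤ ∫ y in a..b, f y := fun a b hab =>
    intervalIntegral.integral_nonneg hab fun y _ => h0 y
  have n1 : ∀ a b, a ≤ b → 0 ≤ ∫ y in a..b, (1 - f y) := fun a b hab =>
    intervalIntegral.integral_nonneg hab fun y _ => h1 y
  have add := fun a b c => intervalIntegral.integral_add_adjacent_intervals (i a b) (i b c)
  have add' := fun a b c => intervalIntegral.integral_add_adjacent_intervals (i' a b) (i' b c)
  have hη : 0 ≤ η := (intervalIntegral.integral_nonneg (by norm_num)
        fun y _ => leaving_nonneg h01 y (y - 0)).trans (h 0 (by simp))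
  -- The half-line is chosen to have the mass of `f`, so that the zeros to the left of `c` and the
  -- ones to the right have the same measure `δ`.
  set c := -1 + ∫ y in (-1)..1, f y with hc
  have hc1 : -1 ≤ c := by linarith [n0 (-1) 1 (by norm_num)]
  have hc2 : c ≤ 1 := by linarith [n1 (-1) 1 (by norm_num), ci (-1) 1]
  set δ := ∫ y in c..1, f y with hδ
  have hδ' : ∫ y in (-1)..c, (1 - f y) = δ := by
    rw [ci, hδ]; linarith [add (-1) c 1]
  have hδ0 : 0 ≤ δ := n0 _ _ hc2
  suffices hmain : δ ≤ 32 * η from ⟨c, ⟨hc1, hc2⟩, hδ' ▸ hmain, hmain⟩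
  by_contra hlt
  push Not at hlt
  have hδpos : 0 < δ := lt_of_le_of_lt (by positivity) hlt
  have mono : ∀ {g : ℝ → ℝ}, (∀ x, 0 ≤ g x) → (∀ a b, IntervalIntegrable g volume a b) →
      ∀ {a b a' b' : ℝ}, a' ≤ a → a ≤ b → b ≤ b' →
      (∫ y in a..b, g y) ≤ ∫ y in a'..b', g y := by
    intro g hg hi a b a' b' h1 h2 h3
    exact intervalIntegral.integral_mono_interval h1 h2 h3
      (Filter.Eventually.of_forall fun y => hg _) (hi _ _)
  have cont : Continuous fun x => ∫ u in (0)..x, f u :=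
    intervalIntegral.continuous_primitive i 0
  have pb : ∀ r, Continuous fun a => ∫ u in (a - r)..a, (1 - f u) := fun r => by
    have : (fun a => ∫ u in (a - r)..a, (1 - f u)) = fun a => a - (a - r) -
        ((∫ u in (0)..a, f u) - ∫ u in (0)..(a - r), f u) := by
      ext a; rw [ci, intervalIntegral.integral_interval_sub_left (i _ _) (i _ _)]
    rw [this]
    exact (by fun_prop : Continuous fun a : ℝ => a - (a - r)).sub
      (cont.sub (cont.comp (by fun_prop : Continuous fun a : ℝ => a - r)))
  have pa : ∀ r, Continuous fun b => ∫ u in b..(b + r), f u := fun r => by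
    have : (fun b => ∫ u in b..(b + r), f u) = fun b =>
        ((∫ u in (0)..(b + r), f u) - ∫ u in (0)..b, f u) := by
      ext a; rw [intervalIntegral.integral_interval_sub_left (i _ _) (i _ _)]
    rw [this]
    exact (cont.comp (by fun_prop : Continuous fun a : ℝ => a + r)).sub cont
  -- the mass of `f` far to the right of `c`
  have hA : c + 4 * δ ≤ 1 → 3 * (∫ y in (c + 4 * δ)..1, f y) ≤ 4 * η := fun hle => by
    have key := integral_pairs_below_le hf h01 h (α := c + 4 * δ) (β := 1) (r := 4 * δ)
      (by linarith) hle le_rfl (by linarith) (by linarith)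
    -- The interval `[a - 4 * δ, a]` lies to the right of `c`, where `f` has mass only `δ`, so it
    -- contains zeros of measure at least `3 * δ`.
    have low : (∫ a in (c + 4 * δ)..1, f a * (3 * δ)) ≤
        ∫ a in (c + 4 * δ)..1, f a * ∫ u in (a - 4 * δ)..a, (1 - f u) := by
      refine intervalIntegral.integral_mono_on hle ((i _ _).mul_const _)
        ((i _ _).mul_continuousOn (pb _).continuousOn) fun a ha => ?_
      refine mul_le_mul_of_nonneg_left ?_ (h0 a)
      rw [ci]
      have := mono h0 i (a := a - 4 * δ) (b := a) (a' := c) (b' := 1) (by linarith [ha.1])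
        (by linarith) ha.2
      linarith
    rw [intervalIntegral.integral_mul_const] at low
    have : δ * (3 * ∫ y in (c + 4 * δ)..1, f y) ≤ δ * (4 * η) := by linarith
    exact le_of_mul_le_mul_left this hδpos
  have hB : -1 ≤ c - 4 * δ → 3 * (∫ y in (-1)..(c - 4 * δ), (1 - f y)) ≤ 4 * η := fun hle => by
    have key := integral_pairs_above_le hf h01 h (α := -1) (β := c - 4 * δ) (r := 4 * δ)
      le_rfl hle (by linarith) (by linarith)
    have low : (∫ b in (-1)..(c - 4 * δ), (1 - f b) * (3 * δ)) ≤
        ∫ b in (-1)..(c - 4 * δ), (1 - f b) * ∫ u in b..(b + 4 * δ), f u := by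
      refine intervalIntegral.integral_mono_on hle ((i' _ _).mul_const _)
        ((i' _ _).mul_continuousOn (pa _).continuousOn) fun b hb => ?_
      refine mul_le_mul_of_nonneg_left ?_ (h1 b)
      have := mono h1 i' (a := b) (b := b + 4 * δ) (a' := -1) (b' := c) hb.1
        (by linarith) (by linarith [hb.2])
      rw [ci] at this
      linarith
    rw [intervalIntegral.integral_mul_const] at low
    have : δ * (3 * ∫ y in (-1)..(c - 4 * δ), (1 - f y)) ≤ δ * (4 * η) := by linarith
    exact le_of_mul_le_mul_left this hδpos
  set lo := max (-1) (c - 4 * δ) with hlo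
  set hi := min 1 (c + 4 * δ) with hhi
  have hp : δ / 2 ≤ ∫ y in lo..c, (1 - f y) := by
    rcases le_total (-1) (c - 4 * δ) with hle | hle
    · rw [hlo, max_eq_right hle]
      linarith [hB hle, add' (-1) (c - 4 * δ) c]
    · rw [hlo, max_eq_left hle]; linarith
  have hq : δ / 2 ≤ ∫ y in c..hi, f y := by
    rcases le_total (c + 4 * δ) 1 with hle | hle
    · rw [hhi, min_eq_right hle]
      linarith [hA hle, add c (c + 4 * δ) 1]
    · rw [hhi, min_eq_left hle]; linarith
  have l1 : -1 ≤ lo := le_max_left _ _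
  have l2 : c - 4 * δ ≤ lo := le_max_right _ _
  have l3 : lo ≤ c := max_le hc1 (by linarith)
  have u1 : hi ≤ 1 := min_le_left _ _
  have u2 : hi ≤ c + 4 * δ := min_le_right _ _
  have u3 : c ≤ hi := le_min hc2 (by linarith)
  -- At least `δ / 2` of each error mass lies within `4 * δ` of `c`. The resulting pairs have
  -- measure at least `(δ / 2) ^ 2`, but at most `(hi - lo) * η ≤ 8 * δ * η`; this gives `δ ≤ 32 *
  -- η`.
  have key := integral_pairs_below_le hf h01 h (α := c) (β := hi) (r := hi - lo) hc1 u3 u1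
    (by linarith) (by linarith)
  have low : (∫ a in c..hi, f a * (δ / 2)) ≤
      ∫ a in c..hi, f a * ∫ u in (a - (hi - lo))..a, (1 - f u) := by
    refine intervalIntegral.integral_mono_on u3 ((i _ _).mul_const _)
      ((i _ _).mul_continuousOn (pb _).continuousOn) fun a ha => ?_
    exact mul_le_mul_of_nonneg_left (hp.trans (mono h1 i' (by linarith [ha.2]) l3 ha.1)) (h0 a)
  rw [intervalIntegral.integral_mul_const] at low
  have e1 : (hi - lo) * η ≤ 8 * δ * η := mul_le_mul_of_nonneg_right (by linarith) hη
  have e2 : δ / 2 * (δ / 2) ≤ (∫ a in c..hi, f a) * (δ / 2) :=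
    mul_le_mul_of_nonneg_right hq (by linarith)
  nlinarith

/-- A binary function for which every translation either adds or removes little mass is close to
the indicator of a half-line. -/
theorem exists_halfline (hf : Measurable f) (h01 : ∀ x, f x = 0 ∨ f x = 1) {η : ℝ}
    (h : ∀ t ∈ Set.Icc (0 : ℝ) 2, (∫ y in (-3)..1, f y * (1 - f (y - t))) ≤ η ∨
      (∫ y in (-3)..1, (1 - f y) * f (y - t)) ≤ η) :
    ∃ c ∈ Set.Icc (-1 : ℝ) 1,
      ((∫ y in (-1)..c, (1 - f y)) ≤ 96 * η ∧ (∫ y in c..1, f y) ≤ 96 * η) ∨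
      ((∫ y in (-1)..c, f y) ≤ 96 * η ∧ (∫ y in c..1, (1 - f y)) ≤ 96 * η) := by
  rcases crossings_one_sided hf h01 h with h | h
  · obtain ⟨c, hc, h1, h2⟩ := exists_left_halfline hf h01 h
    exact ⟨c, hc, Or.inl ⟨by linarith, by linarith⟩⟩
  -- Mass entering `f` is mass leaving `1 - f`. The constant is `96 = 32 * 3`.
  · obtain ⟨c, hc, h1, h2⟩ := exists_left_halfline (f := fun x => 1 - f x) (by fun_prop)
      (fun x => by rcases h01 x with h | h <;> simp [h]) (η := 3 * η)
      (fun t ht => by simpa using h t ht)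
    simp only [sub_sub_cancel] at h1
    exact ⟨c, hc, Or.inr ⟨by linarith, by linarith⟩⟩

end Line

/-! ### Bounded measurable functions and integrals over rectangles. -/

/-- Bounded measurable real functions. -/
def BddMeasurable {α : Type*} [MeasurableSpace α] (g : α → ℝ) : Prop :=
  Measurable g ∧ ∃ C, ∀ z, |g z| ≤ C

namespace BddMeasurable

variable {α β : Type*} [MeasurableSpace α] [MeasurableSpace β] {g h : α → ℝ}

theorem const (c : ℝ) : BddMeasurable fun _ : α => c := ⟨measurable_const, |c|, fun _ => le_rfl⟩

theorem add (hg : BddMeasurable g) (hh : BddMeasurable h) : BddMeasurable fun z => g z + h z := by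
  obtain ⟨m, C, hC⟩ := hg
  obtain ⟨m', C', hC'⟩ := hh
  exact ⟨m.add m', C + C', fun z => (abs_add_le _ _).trans (add_le_add (hC z) (hC' z))⟩

theorem sub (hg : BddMeasurable g) (hh : BddMeasurable h) : BddMeasurable fun z => g z - h z := by
  obtain ⟨m, C, hC⟩ := hg
  obtain ⟨m', C', hC'⟩ := hh
  exact ⟨m.sub m', C + C', fun z => (abs_sub _ _).trans (add_le_add (hC z) (hC' z))⟩

theorem mul (hg : BddMeasurable g) (hh : BddMeasurable h) : BddMeasurable fun z => g z * h z := by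
  obtain ⟨m, C, hC⟩ := hg
  obtain ⟨m', C', hC'⟩ := hh
  refine ⟨m.mul m', C * C', fun z => ?_⟩
  rw [abs_mul]
  exact mul_le_mul (hC z) (hC' z) (abs_nonneg _) ((abs_nonneg _).trans (hC z))

theorem abs (hg : BddMeasurable g) : BddMeasurable fun z => |g z| := by
  obtain ⟨m, C, hC⟩ := hg
  exact ⟨continuous_abs.measurable.comp m, C, fun z => by simpa using hC z⟩

theorem comp (hg : BddMeasurable g) {k : β → α} (hk : Measurable k) :
    BddMeasurable fun z => g (k z) := by
  obtain ⟨m, C, hC⟩ := hg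
  exact ⟨m.comp hk, C, fun z => hC _⟩

theorem intervalIntegrable {g : ℝ → ℝ} (hg : BddMeasurable g) (a b : ℝ) :
    IntervalIntegrable g volume a b := by
  obtain ⟨m, C, hC⟩ := hg
  exact intervalIntegrable_of_measurable_of_bounded m C hC a b

theorem of_binary {f : α → ℝ} (hf : Measurable f) (h01 : ∀ x, f x = 0 ∨ f x = 1) :
    BddMeasurable f :=
  ⟨hf, 1, fun x => by rcases h01 x with h | h <;> simp [h]⟩

theorem integral_right {g : α × ℝ → ℝ} (hg : BddMeasurable g) (c d : ℝ) :
    BddMeasurable fun x => ∫ y in c..d, g (x, y) := by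
  obtain ⟨m, C, hC⟩ := hg
  refine ⟨?_, C * |d - c|, fun x => ?_⟩
  · simp_rw [intervalIntegral]
    exact (StronglyMeasurable.integral_prod_right' (ν := volume.restrict (Set.Ioc c d))
      m.stronglyMeasurable).measurable.sub (StronglyMeasurable.integral_prod_right'
        (ν := volume.restrict (Set.Ioc d c)) m.stronglyMeasurable).measurable
  · exact intervalIntegral.norm_integral_le_of_norm_le_const (f := fun y => g (x, y))
      fun y _ => hC (x, y)

theorem swap {g : ℝ × ℝ → ℝ} (hg : BddMeasurable g) (a b c d : ℝ) :
    ∫ x in a..b, ∫ y in c..d, g (x, y) = ∫ y in c..d, ∫ x in a..b, g (x, y) := by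
  obtain ⟨m, C, hC⟩ := hg
  exact intervalIntegral_intervalIntegral_swap (F := fun x y => g (x, y))
    (integrableOn_of_bounded m C hC (volume_uIoc_prod_ne_top _ _ _ _))

end BddMeasurable

/-- The integral of `g` over the rectangle `[a, b] × [c, d]`. -/
noncomputable def rectIntegral (g : ℝ × ℝ → ℝ) (a b c d : ℝ) : ℝ := ∫ x in a..b, ∫ y in c..d, g (x, y)

section Rect

variable {g h : ℝ × ℝ → ℝ} {a b c d : ℝ}

theorem rectIntegral_add (hg : BddMeasurable g) (hh : BddMeasurable h) :
    rectIntegral (fun z => g z + h z) a b c d = rectIntegral g a b c d + rectIntegral h a b c d := by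
  unfold rectIntegral
  rw [← intervalIntegral.integral_add ((hg.integral_right c d).intervalIntegrable a b)
    ((hh.integral_right c d).intervalIntegrable a b)]
  congr 1; ext x
  exact intervalIntegral.integral_add
    ((hg.comp (by fun_prop : Measurable fun y : ℝ => (x, y))).intervalIntegrable c d)
    ((hh.comp (by fun_prop : Measurable fun y : ℝ => (x, y))).intervalIntegrable c d)

theorem rectIntegral_sub (hg : BddMeasurable g) (hh : BddMeasurable h) :
    rectIntegral (fun z => g z - h z) a b c d = rectIntegral g a b c d - rectIntegral h a b c d := by
  unfold rectIntegral
  rw [← intervalIntegral.integral_sub ((hg.integral_right c d).intervalIntegrable a b)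
    ((hh.integral_right c d).intervalIntegrable a b)]
  congr 1; ext x
  exact intervalIntegral.integral_sub
    ((hg.comp (by fun_prop : Measurable fun y : ℝ => (x, y))).intervalIntegrable c d)
    ((hh.comp (by fun_prop : Measurable fun y : ℝ => (x, y))).intervalIntegrable c d)

theorem rectIntegral_mono (hg : BddMeasurable g) (hh : BddMeasurable h) (hab : a ≤ b) (hcd : c ≤ d)
    (hgh : ∀ z, g z ≤ h z) : rectIntegral g a b c d ≤ rectIntegral h a b c d :=
  intervalIntegral.integral_mono_on hab ((hg.integral_right c d).intervalIntegrable a b)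
    ((hh.integral_right c d).intervalIntegrable a b) fun x _ =>
    intervalIntegral.integral_mono_on hcd
      ((hg.comp (by fun_prop : Measurable fun y : ℝ => (x, y))).intervalIntegrable c d)
      ((hh.comp (by fun_prop : Measurable fun y : ℝ => (x, y))).intervalIntegrable c d)
      fun y _ => hgh (x, y)

theorem rectIntegral_mono_rect (hg : BddMeasurable g) (h0 : ∀ z, 0 ≤ g z) {a' b' c' d' : ℝ}
    (ha : a' ≤ a) (hab : a ≤ b) (hb : b ≤ b') (hc : c' ≤ c) (hcd : c ≤ d) (hd : d ≤ d') :
    rectIntegral g a b c d ≤ rectIntegral g a' b' c' d' := by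
  have hx : ∀ x, BddMeasurable fun y : ℝ => g (x, y) := fun x =>
    hg.comp (by fun_prop : Measurable fun y : ℝ => (x, y))
  calc rectIntegral g a b c d ≤ rectIntegral g a b c' d' :=
        intervalIntegral.integral_mono_on hab ((hg.integral_right c d).intervalIntegrable a b)
          ((hg.integral_right c' d').intervalIntegrable a b) fun x _ =>
          intervalIntegral.integral_mono_interval hc hcd hd
            (Filter.Eventually.of_forall fun y => h0 _) ((hx x).intervalIntegrable _ _)
    _ ≤ rectIntegral g a' b' c' d' :=
        intervalIntegral.integral_mono_interval ha hab hb
          (Filter.Eventually.of_forall fun x =>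
            intervalIntegral.integral_nonneg (by linarith) fun y _ => h0 _)
          ((hg.integral_right c' d').intervalIntegrable _ _)

theorem rectIntegral_snd (k : ℝ → ℝ) :
    rectIntegral (fun z => k z.2) a b c d = (b - a) * ∫ y in c..d, k y := by
  simp [rectIntegral]

theorem rectIntegral_comp_sub (p q : ℝ) :
    rectIntegral (fun z => g (z - (p, q))) a b c d =
      rectIntegral g (a - p) (b - p) (c - q) (d - q) := by
  unfold rectIntegral
  rw [← intervalIntegral.integral_comp_sub_right (fun x => ∫ y in (c - q)..(d - q), g (x, y)) p]
  congr 1; ext x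
  rw [← intervalIntegral.integral_comp_sub_right (fun y => g (x - p, y)) q]
  rfl

end Rect

/-! ### Binary functions on the plane: reduction to one variable. -/

section Plane

variable {f : ℝ × ℝ → ℝ}

theorem BddMeasurable.leaving (hf : BddMeasurable f) (w : ℝ × ℝ) :
    BddMeasurable fun z => f z * (1 - f (z - w)) :=
  hf.mul ((BddMeasurable.const 1).sub (hf.comp (by fun_prop)))

theorem BddMeasurable.entering (hf : BddMeasurable f) (w : ℝ × ℝ) :
    BddMeasurable fun z => (1 - f z) * f (z - w) :=
  ((BddMeasurable.const 1).sub hf).mul (hf.comp (by fun_prop))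

theorem BddMeasurable.absDiff (hf : BddMeasurable f) (w : ℝ × ℝ) :
    BddMeasurable fun z => |f z - f (z - w)| :=
  (hf.sub (hf.comp (by fun_prop))).abs

/-- If a binary function on the plane is almost invariant under one horizontal translation and
each translation adds or removes little mass, then it is almost invariant under all shorter
horizontal translations. -/
theorem rectIntegral_abs_sub_shift_le (hf : Measurable f) (h01 : ∀ z, f z = 0 ∨ f z = 1) {η : ℝ}
    (h : ∀ p q : ℝ, p ^ 2 + q ^ 2 ≤ 16 →
      rectIntegral (fun z => f z * (1 - f (z - (p, q)))) (-3) 1 (-5) 1 ≤ η ∨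
      rectIntegral (fun z => (1 - f z) * f (z - (p, q))) (-3) 1 (-5) 1 ≤ η)
    (hper : rectIntegral (fun z => |f z - f (z - (4, 0))|) (-3) 1 (-5) 1 ≤ 2 * η)
    {s : ℝ} (hs : 0 ≤ s) (hs4 : s ≤ 4) :
    rectIntegral (fun z => |f z - f (z - (s, 0))|) (-3) 1 (-5) 1 ≤ 6 * η := by
  have hb := BddMeasurable.of_binary hf h01
  have hsh : ∀ w : ℝ × ℝ, BddMeasurable fun z => f (z - w) := fun w => hb.comp (by fun_prop)
  have e1 : rectIntegral (fun z => (1 - f z) * f (z - (s, 0))) (-3) 1 (-5) 1 -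
      rectIntegral (fun z => f z * (1 - f (z - (s, 0)))) (-3) 1 (-5) 1 =
      rectIntegral (fun z => f (z - (s, 0))) (-3) 1 (-5) 1 - rectIntegral f (-3) 1 (-5) 1 := by
    rw [← rectIntegral_sub (hb.entering _) (hb.leaving _), ← rectIntegral_sub (hsh _) hb]
    congr 1; ext z; ring
  have e2 : rectIntegral (fun z => |f z - f (z - (s, 0))|) (-3) 1 (-5) 1 =
      rectIntegral (fun z => (1 - f z) * f (z - (s, 0))) (-3) 1 (-5) 1 +
      rectIntegral (fun z => f z * (1 - f (z - (s, 0)))) (-3) 1 (-5) 1 := by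
    rw [← rectIntegral_add (hb.entering _) (hb.leaving _)]
    congr 1; ext z
    rcases h01 z with h | h <;> rcases h01 (z - (s, 0)) with h' | h' <;> simp [h, h']
  have i := (hb.integral_right (-5) 1).intervalIntegrable
  -- The length 4 of the almost period equals the width of the rectangle: the strip gained on the
  -- left is the translate by 4 of the strip lost on the right. The net gain of the shift by `s` is
  -- thus at most `2 * η` in absolute value.
  have e3 : rectIntegral (fun z => f (z - (s, 0))) (-3) 1 (-5) 1 - rectIntegral f (-3) 1 (-5) 1 =
      rectIntegral (fun z => f (z - (4, 0)) - f z) (1 - s) 1 (-5) 1 := by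
    rw [rectIntegral_sub (hsh _) hb, rectIntegral_comp_sub, rectIntegral_comp_sub]
    unfold rectIntegral
    have a1 := intervalIntegral.integral_add_adjacent_intervals (i (-3 - s) (-3)) (i (-3) (1 - s))
    have a2 := intervalIntegral.integral_add_adjacent_intervals (i (-3) (1 - s)) (i (1 - s) 1)
    have c1 : (1 : ℝ) - s - 4 = -3 - s := by ring
    have c2 : (1 : ℝ) - 4 = -3 := by norm_num
    simp only [sub_zero, c1, c2]
    linarith
  have m1 : ∀ {g : ℝ × ℝ → ℝ}, BddMeasurable g → (∀ z, g z ≤ |f z - f (z - (4, 0))|) →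
      rectIntegral g (1 - s) 1 (-5) 1 ≤ 2 * η := by
    intro g hg hle
    exact ((rectIntegral_mono hg (hb.absDiff _) (by linarith) (by norm_num) hle).trans
      (rectIntegral_mono_rect (hb.absDiff _) (fun z => abs_nonneg _) (by linarith) (by linarith)
        le_rfl le_rfl (by norm_num) le_rfl)).trans hper
  have b1 := m1 ((hsh (4, 0)).sub hb) (fun z => by rw [abs_sub_comm]; exact le_abs_self _)
  have b2 := m1 (hb.sub (hsh (4, 0))) (fun z => le_abs_self _)
  rw [rectIntegral_sub (hsh _) hb] at b1 e3
  rw [rectIntegral_sub hb (hsh _)] at b2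
  rcases h s 0 (by nlinarith) with h | h <;> linarith

/-- By averaging: for `x ∈ [-1, 1]` and `x' ∈ [-3, -1]` the shift `x - x'` lies in `[0, 4]`, so the
distances between the slices at `x` and `x'` integrate to at most `4 * (6 * η)`. As `x'` ranges over
an interval of length 2, some `x'` does no worse than `12 * η`. -/
theorem exists_close_slice (hf : Measurable f) (h01 : ∀ z, f z = 0 ∨ f z = 1) {η : ℝ}
    (h : ∀ s ∈ Set.Icc (0 : ℝ) 4,
      rectIntegral (fun z => |f z - f (z - (s, 0))|) (-3) 1 (-5) 1 ≤ 6 * η) :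
    ∃ x₀ : ℝ, rectIntegral (fun z => |f z - f (x₀, z.2)|) (-1) 1 (-5) 1 ≤ 12 * η := by
  have hb := BddMeasurable.of_binary hf h01
  set D : ℝ × ℝ → ℝ := fun z => ∫ y in (-5)..1, |f (z.1, y) - f (z.1 - z.2, y)| with hD
  have hD0 : ∀ z, 0 ≤ D z := fun z =>
    intervalIntegral.integral_nonneg (by norm_num) fun y _ => abs_nonneg _
  have hDb : BddMeasurable D := by
    refine BddMeasurable.integral_right
      (g := fun w : (ℝ × ℝ) × ℝ => |f (w.1.1, w.2) - f (w.1.1 - w.1.2, w.2)|) ?_ (-5) 1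
    exact ((hb.comp (by fun_prop)).sub (hb.comp (by fun_prop))).abs
  have hDx : ∀ x, BddMeasurable fun s => D (x, s) := fun x => hDb.comp (by fun_prop)
  have hDs : BddMeasurable fun z : ℝ × ℝ => D (z.2, z.2 - z.1) := hDb.comp (by fun_prop)
  have key : ∫ x' in (-3)..(-1), ∫ x in (-1)..1, D (x, x - x') ≤ 24 * η := by
    rw [BddMeasurable.swap (g := fun z : ℝ × ℝ => D (z.2, z.2 - z.1)) hDs]
    have s1 : ∀ x, ∫ x' in (-3)..(-1), D (x, x - x') = ∫ s in (x + 1)..(x + 3), D (x, s) := by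
      intro x
      rw [intervalIntegral.integral_comp_sub_left (fun s => D (x, s)) x]
      congr 1 <;> ring
    calc ∫ x in (-1)..1, ∫ x' in (-3)..(-1), D (x, x - x')
        ≤ ∫ x in (-1)..1, ∫ s in (0)..4, D (x, s) := by
          refine intervalIntegral.integral_mono_on (by norm_num) ?_
            ((hDb.integral_right 0 4).intervalIntegrable _ _) fun x hx => ?_
          · exact (BddMeasurable.integral_right (g := fun z : ℝ × ℝ => D (z.1, z.1 - z.2))
              (hDb.comp (by fun_prop)) (-3) (-1)).intervalIntegrable _ _
          · rw [s1]
            exact intervalIntegral.integral_mono_interval (by linarith [hx.1]) (by linarith)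
              (by linarith [hx.2]) (Filter.Eventually.of_forall fun s => hD0 _)
              ((hDx x).intervalIntegrable _ _)
      _ = ∫ s in (0)..4, ∫ x in (-1)..1, D (x, s) := hDb.swap _ _ _ _
      _ ≤ ∫ s in (0 : ℝ)..4, 6 * η := by
          refine intervalIntegral.integral_mono_on (by norm_num) ?_ (by simp) fun s hs => ?_
          · exact (BddMeasurable.integral_right (g := fun z : ℝ × ℝ => D (z.2, z.1))
              (hDb.comp (by fun_prop)) (-1) 1).intervalIntegrable _ _
          · have := h s hs
            refine le_trans ?_ this
            refine le_trans (le_of_eq ?_) (rectIntegral_mono_rect (hb.absDiff _)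
              (fun z => abs_nonneg _) (by norm_num : (-3 : ℝ) ≤ -1) (by norm_num) le_rfl le_rfl
                (by norm_num) le_rfl)
            simp [rectIntegral, hD]
      _ = 24 * η := by simp; ring
  by_contra hcon
  push Not at hcon
  have hG : BddMeasurable fun x' => ∫ x in (-1)..1, D (x, x - x') :=
    BddMeasurable.integral_right (g := fun z : ℝ × ℝ => D (z.2, z.2 - z.1)) hDs (-1) 1
  have pos := intervalIntegral.intervalIntegral_pos_of_pos_on (a := -3) (b := -1)
    ((hG.sub (BddMeasurable.const (12 * η))).intervalIntegrable _ _)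
    (fun x' _ => by
      have := hcon x'
      simp only [rectIntegral] at this
      simpa [hD] using this) (by norm_num)
  rw [intervalIntegral.integral_sub (hG.intervalIntegrable _ _) (by simp)] at pos
  simp only [intervalIntegral.integral_const, smul_eq_mul] at pos
  linarith

/-- A binary function on the plane that is almost invariant under a horizontal translation and for
which each translation adds or removes little mass is close, on the unit square, to the indicator
of a horizontal half-plane. -/
theorem exists_horizontal_halfplane (hf : Measurable f) (h01 : ∀ z, f z = 0 ∨ f z = 1) {η : ℝ}
    (h : ∀ p q : ℝ, p ^ 2 + q ^ 2 ≤ 16 →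
      rectIntegral (fun z => f z * (1 - f (z - (p, q)))) (-3) 1 (-5) 1 ≤ η ∨
      rectIntegral (fun z => (1 - f z) * f (z - (p, q))) (-3) 1 (-5) 1 ≤ η)
    (hper : rectIntegral (fun z => |f z - f (z - (4, 0))|) (-3) 1 (-5) 1 ≤ 2 * η) :
    ∃ c ∈ Set.Icc (-1 : ℝ) 1,
      (rectIntegral (fun z => 1 - f z) (-1) 1 (-1) c ≤ 2508 * η ∧
        rectIntegral f (-1) 1 c 1 ≤ 2508 * η) ∨
      (rectIntegral f (-1) 1 (-1) c ≤ 2508 * η ∧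
        rectIntegral (fun z => 1 - f z) (-1) 1 c 1 ≤ 2508 * η) := by
  have hb := BddMeasurable.of_binary hf h01
  obtain ⟨x₀, hx₀⟩ := exists_close_slice hf h01 (η := η) fun s hs =>
    rectIntegral_abs_sub_shift_le hf h01 h hper hs.1 hs.2
  set k : ℝ → ℝ := fun y => f (x₀, y) with hk
  have hkm : Measurable k := by rw [hk]; fun_prop
  have hk01 : ∀ y, k y = 0 ∨ k y = 1 := fun y => h01 _
  have hkb := BddMeasurable.of_binary hkm hk01
  have hk2 : BddMeasurable fun z : ℝ × ℝ => k z.2 := hkb.comp (by fun_prop)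
  have hd : BddMeasurable fun z : ℝ × ℝ => |f z - k z.2| := (hb.sub hk2).abs
  have hη : 0 ≤ η := by
    have : 0 ≤ rectIntegral (fun z => |f z - f (z - (4, 0))|) (-3) 1 (-5) 1 :=
      intervalIntegral.integral_nonneg (by norm_num) fun x _ =>
        intervalIntegral.integral_nonneg (by norm_num) fun y _ => abs_nonneg _
    linarith
  have d1 : rectIntegral (fun z => |f z - k z.2|) (-1) 1 (-3) 1 ≤ 12 * η :=
    (rectIntegral_mono_rect hd (fun z => abs_nonneg _) le_rfl (by norm_num) le_rfl (by norm_num)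
      (by norm_num) le_rfl).trans hx₀
  -- A vertical shift by at most 2 carries `[-3, 1]` into `[-5, 1]`; this is why the rectangles
  -- start at `-5`.
  have d2 : ∀ t ∈ Set.Icc (0 : ℝ) 2,
      rectIntegral (fun z => |f (z - (0, t)) - k (z - (0, t)).2|) (-1) 1 (-3) 1 ≤ 12 * η := by
    intro t ht
    rw [rectIntegral_comp_sub (g := fun z => |f z - k z.2|)]
    exact (rectIntegral_mono_rect hd (fun z => abs_nonneg _) (by norm_num) (by norm_num)
      (by norm_num) (by linarith [ht.2]) (by linarith) (by linarith [ht.1])).trans hx₀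
  have hd2 : ∀ t, BddMeasurable fun z : ℝ × ℝ => |f (z - (0, t)) - k (z - (0, t)).2| :=
    fun t => hd.comp (k := fun z : ℝ × ℝ => z - (0, t)) (by fun_prop)
  have hk3 : ∀ t, BddMeasurable fun z : ℝ × ℝ => k (z - (0, t)).2 :=
    fun t => hk2.comp (k := fun z : ℝ × ℝ => z - (0, t)) (by fun_prop)
  have one := BddMeasurable.const (α := ℝ × ℝ) 1
  -- Replacing `f` by `k` at both points costs `12 * η` twice, so the crossing over a strip of width
  -- 2 is at most `25 * η`; half of that is below `13 * η`.
  have hline : ∀ t ∈ Set.Icc (0 : ℝ) 2, (∫ y in (-3)..1, k y * (1 - k (y - t))) ≤ 13 * η ∨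
      (∫ y in (-3)..1, (1 - k y) * k (y - t)) ≤ 13 * η := by
    intro t ht
    have := d2 t ht
    rcases h 0 t (by nlinarith [ht.1, ht.2]) with h | h
    · left
      have e := rectIntegral_snd (a := -1) (b := 1) (c := -3) (d := 1)
        (fun y => k y * (1 - k (y - t)))
      have m := rectIntegral_mono (a := -1) (b := 1) (c := -3) (d := 1)
        (g := fun z => k z.2 * (1 - k (z.2 - t)))
        (h := fun z => f z * (1 - f (z - (0, t))) + (|f z - k z.2| +
          |f (z - (0, t)) - k (z - (0, t)).2|)) (hk2.mul (one.sub (hk3 t)))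
        ((hb.leaving _).add (hd.add (hd2 t))) (by norm_num) (by norm_num) (fun z => by
          rw [Prod.snd_sub]
          rcases h01 z with h | h <;> rcases h01 (z - (0, t)) with h' | h' <;>
          rcases hk01 z.2 with h2 | h2 <;> rcases hk01 (z.2 - t) with h3 | h3 <;>
          norm_num [h, h', h2, h3])
      rw [rectIntegral_add (hb.leaving _) (hd.add (hd2 t)), rectIntegral_add hd (hd2 t), e] at m
      have m2 := rectIntegral_mono_rect (a := -1) (b := 1) (c := -3) (d := 1) (hb.leaving (0, t))
        (fun z => leaving_nonneg h01 _ _) (by norm_num : (-3 : ℝ) ≤ -1) (by norm_num) le_rfl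
        (by norm_num : (-5 : ℝ) ≤ -3) (by norm_num) le_rfl
      linarith
    · right
      have e := rectIntegral_snd (a := -1) (b := 1) (c := -3) (d := 1)
        (fun y => (1 - k y) * k (y - t))
      have m := rectIntegral_mono (a := -1) (b := 1) (c := -3) (d := 1)
        (g := fun z => (1 - k z.2) * k (z.2 - t))
        (h := fun z => (1 - f z) * f (z - (0, t)) + (|f z - k z.2| +
          |f (z - (0, t)) - k (z - (0, t)).2|)) ((one.sub hk2).mul (hk3 t))
        ((hb.entering _).add (hd.add (hd2 t))) (by norm_num) (by norm_num) (fun z => by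
          rw [Prod.snd_sub]
          rcases h01 z with h | h <;> rcases h01 (z - (0, t)) with h' | h' <;>
          rcases hk01 z.2 with h2 | h2 <;> rcases hk01 (z.2 - t) with h3 | h3 <;>
          norm_num [h, h', h2, h3])
      rw [rectIntegral_add (hb.entering _) (hd.add (hd2 t)), rectIntegral_add hd (hd2 t), e] at m
      have m2 := rectIntegral_mono_rect (a := -1) (b := 1) (c := -3) (d := 1) (hb.entering (0, t))
        (fun z => entering_nonneg h01 _ _) (by norm_num : (-3 : ℝ) ≤ -1) (by norm_num) le_rfl
        (by norm_num : (-5 : ℝ) ≤ -3) (by norm_num) le_rfl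
      linarith
  obtain ⟨c, hc, hcc⟩ := exists_halfline hkm hk01 hline
  have up : ∀ {c d : ℝ}, -1 ≤ c → c ≤ d → d ≤ 1 →
      rectIntegral f (-1) 1 c d ≤ 2 * (∫ y in c..d, k y) + 12 * η := by
    intro c d h1 h2 h3
    have m := rectIntegral_mono (a := -1) (b := 1) (c := c) (d := d) hb (hk2.add hd)
      (by norm_num) h2 (fun z => by linarith [le_abs_self (f z - k z.2)])
    rw [rectIntegral_add hk2 hd, rectIntegral_snd] at m
    have := rectIntegral_mono_rect (a := -1) (b := 1) (c := c) (d := d) hd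
      (fun z => abs_nonneg _) le_rfl (by norm_num) le_rfl (by linarith : (-3 : ℝ) ≤ c) h2 h3
    linarith
  have lo : ∀ {c d : ℝ}, -1 ≤ c → c ≤ d → d ≤ 1 →
      rectIntegral (fun z => 1 - f z) (-1) 1 c d ≤ 2 * (∫ y in c..d, (1 - k y)) + 12 * η := by
    intro c d h1 h2 h3
    have m := rectIntegral_mono (a := -1) (b := 1) (c := c) (d := d) (one.sub hb)
      ((one.sub hk2).add hd)
      (by norm_num) h2 (fun z => by linarith [neg_abs_le (f z - k z.2)])
    rw [rectIntegral_add (one.sub hk2) hd,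
      rectIntegral_snd (fun y => 1 - k y)] at m
    have := rectIntegral_mono_rect (a := -1) (b := 1) (c := c) (d := d) hd
      (fun z => abs_nonneg _) le_rfl (by norm_num) le_rfl (by linarith : (-3 : ℝ) ≤ c) h2 h3
    linarith
  -- The constant is `2508 = 2 * (96 * 13) + 12`.
  refine ⟨c, hc, ?_⟩
  rcases hcc with ⟨h1, h2⟩ | ⟨h1, h2⟩
  · left
    have := lo le_rfl hc.1 hc.2
    have := up hc.1 hc.2 le_rfl
    constructor <;> linarith
  · right
    have := up le_rfl hc.1 hc.2
    have := lo hc.1 hc.2 le_rfl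
    constructor <;> linarith

end Plane

/-! ### Second-order expansion of the kernel. -/

/-- Writing `u ^ (-q) = u ^ (2 - q) / u ^ 2` makes the numerator a concave power, to which
Bernoulli's inequality applies. Clearing the denominator leaves an error of at most `4 * w ^ 2 ≤ 25
* ε ^ 2` with `w = u - 1`, and `400 = 25 * 16` absorbs `u ^ 2 ≥ 1 / 16`. -/
theorem rpow_neg_le_quadratic {u q ε : ℝ} (hq1 : 1 ≤ q) (hq2 : q ≤ 3 / 2) (hu : 1 / 4 ≤ u)
    (hε0 : 0 ≤ ε) (hε : ε ≤ 1 / 2) (h : |u - 1| ≤ 5 / 2 * ε) :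
    u ^ (-q) ≤ 1 - q * (u - 1) + 400 * ε ^ 2 := by
  have hu0 : 0 < u := by linarith
  obtain ⟨w, rfl⟩ : ∃ w, u = 1 + w := ⟨u - 1, by ring⟩
  have e : (1 + w) ^ (-q) = (1 + w) ^ (2 - q) / (1 + w) ^ 2 := by
    rw [← Real.rpow_natCast, ← Real.rpow_sub hu0]; congr 1; push_cast; ring
  have b := rpow_one_add_le_one_add_mul_self (s := w) (p := 2 - q) (by linarith)
    (by linarith) (by linarith)
  rw [add_sub_cancel_left] at h ⊢
  have hw : w ^ 2 ≤ 25 / 4 * ε ^ 2 := by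
    have := sq_le_sq' (by linarith [abs_nonneg w]) h
    rw [sq_abs] at this; linarith
  have hw' : |w| ≤ 5 / 4 := by linarith
  have hu2 : 1 / 16 ≤ (1 + w) ^ 2 := by nlinarith
  rw [e, div_le_iff₀ (by positivity)]
  refine b.trans ?_
  have key : 1 + (2 - q) * w - (1 - q * w) * (1 + w) ^ 2 = ((2 * q - 1) + q * w) * w ^ 2 := by
    ring
  have c1 : (2 * q - 1) + q * w ≤ 4 := by nlinarith [le_abs_self w]
  have c2 : ((2 * q - 1) + q * w) * w ^ 2 ≤ 4 * w ^ 2 := by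
    exact mul_le_mul_of_nonneg_right c1 (sq_nonneg w)
  have c3 : 400 * ε ^ 2 * (1 / 16) ≤ 400 * ε ^ 2 * (1 + w) ^ 2 :=
    mul_le_mul_of_nonneg_left hu2 (by positivity)
  nlinarith

/-- The terms linear in `ξ`, `α`, `β` change sign between the two summands and cancel. The term in
`κ` is of second order and enters with a favourable sign. -/
theorem rpow_second_difference {q ε ξ κ α β : ℝ} (hq1 : 1 ≤ q) (hq2 : q ≤ 3 / 2)
    (hε0 : 0 ≤ ε) (hε : ε ≤ 1 / 2) (hξ : |ξ| ≤ 2 * ε) (hκ0 : 0 ≤ κ) (hκ : κ ≤ ε ^ 2)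
    (hα : |α| ≤ ε) (hβ : |β| ≤ ε) (hu : 1 / 4 ≤ 1 + ξ + κ) (hv : 1 / 4 ≤ 1 - ξ + κ) :
    (1 + ξ + κ) ^ (-q) * ((1 + α) * (1 + β)) + (1 - ξ + κ) ^ (-q) * ((1 - α) * (1 - β)) ≤
      2 + 1100 * ε ^ 2 := by
  obtain ⟨hξ1, hξ2⟩ := abs_le.1 hξ
  obtain ⟨hα1, hα2⟩ := abs_le.1 hα
  obtain ⟨hβ1, hβ2⟩ := abs_le.1 hβ
  have hεε : ε ^ 2 ≤ ε / 2 := by nlinarith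
  have h1 := rpow_neg_le_quadratic hq1 hq2 hu hε0 hε
    (abs_le.2 ⟨by linarith, by linarith⟩)
  have h2 := rpow_neg_le_quadratic hq1 hq2 hv hε0 hε
    (abs_le.2 ⟨by linarith, by linarith⟩)
  have hqκ : 0 ≤ q * κ := by positivity
  have h1' : (1 + ξ + κ) ^ (-q) ≤ 1 - q * ξ + 400 * ε ^ 2 := by linarith
  have h2' : (1 - ξ + κ) ^ (-q) ≤ 1 + q * ξ + 400 * ε ^ 2 := by linarith
  have p1 := mul_le_mul_of_nonneg_right h1'
    (mul_nonneg (by linarith) (by linarith) : 0 ≤ (1 + α) * (1 + β))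
  have p2 := mul_le_mul_of_nonneg_right h2'
    (mul_nonneg (by linarith) (by linarith) : 0 ≤ (1 - α) * (1 - β))
  have hαβ : α * β ≤ ε ^ 2 := by
    have := (le_abs_self (α * β)).trans (by rw [abs_mul])
    nlinarith [abs_nonneg α, abs_nonneg β]
  have hξα : -(q * ξ * (α + β)) ≤ 6 * ε ^ 2 := by
    have a1 : |q * ξ * (α + β)| ≤ 3 / 2 * (2 * ε) * (2 * ε) := by
      rw [abs_mul, abs_mul, abs_of_nonneg (by linarith : 0 ≤ q)]
      gcongr
      exact (abs_add_le _ _).trans (by linarith)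
    linarith [neg_abs_le (q * ξ * (α + β))]
  have hε4 : ε ^ 2 * (α * β) ≤ ε ^ 2 * (1 / 4) :=
    mul_le_mul_of_nonneg_left (by nlinarith) (sq_nonneg ε)
  nlinarith

/-- Second difference of the kernel `|a|^{-(2 + 2s)}`, weighted by Jacobian factors. -/
theorem kernel_second_difference {V : Type*} [NormedAddCommGroup V] [InnerProductSpace ℝ V]
    {s : ℝ} (hs0 : 0 < s) (hs1 : s < 1 / 2) {a v : V} (ha : a ≠ 0) {ε d α β : ℝ}
    (hε : ε ≤ 1 / 2) (hd : |d| * ‖v‖ ≤ ε * ‖a‖) (hα : |α| ≤ ε) (hβ : |β| ≤ ε) :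
    1 / ‖a + d • v‖ ^ (2 + 2 * s) * ((1 + α) * (1 + β)) +
      1 / ‖a - d • v‖ ^ (2 + 2 * s) * ((1 - α) * (1 - β)) ≤
      (2 + 1100 * ε ^ 2) * (1 / ‖a‖ ^ (2 + 2 * s)) := by
  have hε0 : 0 ≤ ε := (abs_nonneg _).trans hα
  have hna : 0 < ‖a‖ := norm_pos_iff.2 ha
  have hdv : ‖d • v‖ ≤ ε * ‖a‖ := by rwa [norm_smul]
  -- These are the linear and quadratic parts of `‖a ± d • v‖ ^ 2 / ‖a‖ ^ 2 = 1 ± ξ + κ`; the kernel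
  -- is the power `-(1 + s)` of the squared norm.
  set ξ := 2 * inner ℝ a (d • v) / ‖a‖ ^ 2 with hξ
  set κ := ‖d • v‖ ^ 2 / ‖a‖ ^ 2 with hκ
  have e1 : ‖a + d • v‖ ^ 2 = ‖a‖ ^ 2 * (1 + ξ + κ) := by
    rw [norm_add_sq_real, hξ, hκ]; field_simp
  have e2 : ‖a - d • v‖ ^ 2 = ‖a‖ ^ 2 * (1 - ξ + κ) := by
    rw [norm_sub_sq_real, hξ, hκ]; field_simp
  have low : ∀ {t : ℝ} {b : V}, ‖a‖ / 2 ≤ ‖b‖ → ‖b‖ ^ 2 = ‖a‖ ^ 2 * t → 1 / 4 ≤ t := by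
    intro t b hb hbt
    have : (‖a‖ / 2) ^ 2 ≤ ‖b‖ ^ 2 := by gcongr
    rw [hbt] at this
    have h2 : ‖a‖ ^ 2 * (1 / 4) ≤ ‖a‖ ^ 2 * t := by linarith
    exact le_of_mul_le_mul_left h2 (by positivity)
  have hhalf : ε * ‖a‖ ≤ 1 / 2 * ‖a‖ := by gcongr
  have hu : 1 / 4 ≤ 1 + ξ + κ := low (by
    have := norm_sub_norm_le a (-(d • v))
    rw [norm_neg, sub_neg_eq_add] at this; linarith) e1
  have hv : 1 / 4 ≤ 1 - ξ + κ := low (by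
    have := norm_sub_norm_le a (d • v)
    linarith) e2
  have pw : ∀ {t : ℝ} {b : V}, 1 / 4 ≤ t → ‖b‖ ^ 2 = ‖a‖ ^ 2 * t →
      1 / ‖b‖ ^ (2 + 2 * s) = 1 / ‖a‖ ^ (2 + 2 * s) * t ^ (-(1 + s)) := by
    intro t b ht hbt
    have ht0 : 0 < t := by linarith
    have r : ∀ c : V, ‖c‖ ^ (2 + 2 * s) = (‖c‖ ^ 2) ^ (1 + s) := fun c => by
      rw [← Real.rpow_natCast, ← Real.rpow_mul (norm_nonneg _)]; congr 1; push_cast; ring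
    rw [r b, r a, hbt, Real.mul_rpow (by positivity) ht0.le, Real.rpow_neg ht0.le]
    field_simp
  rw [pw hu e1, pw hv e2]
  have hξb : |ξ| ≤ 2 * ε := by
    rw [hξ, abs_div, abs_of_pos (by positivity : 0 < ‖a‖ ^ 2), div_le_iff₀ (by positivity), abs_mul,
      abs_two]
    have := (abs_real_inner_le_norm a (d • v)).trans
      (mul_le_mul_of_nonneg_left hdv (norm_nonneg a))
    nlinarith
  have hκb : κ ≤ ε ^ 2 := by
    rw [hκ, div_le_iff₀ (by positivity), ← mul_pow]
    gcongr
  have main := rpow_second_difference (q := 1 + s) (by linarith) (by linarith) hε0 hε hξb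
    (by positivity) hκb hα hβ hu hv
  have hpos : 0 ≤ 1 / ‖a‖ ^ (2 + 2 * s) := by positivity
  have := mul_le_mul_of_nonneg_left main hpos
  linarith

/-! ### Finiteness and scaling of the perimeter of a ball. -/

/-- The Euclidean plane. -/
abbrev Plane := EuclideanSpace ℝ (Fin 2)

/-- The interaction kernel of the plane. -/
noncomputable def sKernel (s : ℝ) (p : Plane × Plane) : ENNReal :=
  ENNReal.ofReal (1 / ‖p.1 - p.2‖ ^ (((2 : ℕ) : ℝ) + 2 * s))

theorem measurable_sKernel (s : ℝ) : Measurable (sKernel s) := by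
  unfold sKernel
  fun_prop

theorem sInteraction_eq (s : ℝ) (S₁ S₂ : Set Plane) :
    sInteraction s S₁ S₂ = ∫⁻ p in S₁ ×ˢ S₂, sKernel s p := rfl

/-- For `‖z‖ ≤ 1` such points lie in the annulus `1 - ‖z‖ ≤ ‖y‖ < 1`, whose share of the disc is `1
- (1 - ‖z‖) ^ 2 ≤ 2 * ‖z‖`. -/
theorem volume_ball_diff_le (z : Plane) :
    volume {y : Plane | y ∈ Metric.ball 0 1 ∧ z + y ∉ Metric.ball 0 1} ≤
      ENNReal.ofReal (2 * min 1 ‖z‖) * volume (Metric.ball (0 : Plane) 1) := by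
  rcases le_total 1 ‖z‖ with h | h
  · rw [min_eq_left h]
    calc _ ≤ volume (Metric.ball (0 : Plane) 1) := measure_mono fun y hy => hy.1
      _ = 1 * volume (Metric.ball (0 : Plane) 1) := (one_mul _).symm
      _ ≤ _ := by
        gcongr
        rw [← ENNReal.ofReal_one]
        exact ENNReal.ofReal_le_ofReal (by norm_num)
  · rw [min_eq_right h]
    have hsub : {y : Plane | y ∈ Metric.ball 0 1 ∧ z + y ∉ Metric.ball 0 1} ⊆
        Metric.ball 0 1 \ Metric.ball 0 (1 - ‖z‖) := by
      rintro y ⟨h1, h2⟩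
      refine ⟨h1, fun h3 => h2 ?_⟩
      rw [mem_ball_zero_iff] at h3 ⊢
      linarith [norm_add_le z y]
    refine (measure_mono hsub).trans ?_
    rw [measure_sdiff (Metric.ball_subset_ball (by linarith [norm_nonneg z]))
      measurableSet_ball.nullMeasurableSet measure_ball_lt_top.ne,
      Measure.addHaar_ball _ _ (by linarith : 0 ≤ 1 - ‖z‖), finrank_euclideanSpace_fin]
    rw [tsub_le_iff_right, ← add_mul, ← ENNReal.ofReal_add (by positivity) (by positivity)]
    calc volume (Metric.ball (0 : Plane) 1) = 1 * volume (Metric.ball (0 : Plane) 1) :=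
          (one_mul _).symm
      _ ≤ _ := by
        gcongr
        rw [← ENNReal.ofReal_one]
        exact ENNReal.ofReal_le_ofReal (by nlinarith [sq_nonneg ‖z‖])

/-- In polar coordinates the integrand is `2 * r ^ (-2s)` near zero, integrable because `s < 1/2`,
and `2 * r ^ (-1-2s)` at infinity, integrable because `s > 0`. -/
theorem lintegral_kernel_mul_min_ne_top {s : ℝ} (hs0 : 0 < s) (hs1 : s < 1 / 2) :
    ∫⁻ z : Plane, sKernel s (z, 0) * ENNReal.ofReal (2 * min 1 ‖z‖) ≠ ⊤ := by
  set g : ℝ → ℝ := fun r => 1 / r ^ (((2 : ℕ) : ℝ) + 2 * s) * (2 * min 1 r) with hg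
  have e : ∀ z : Plane, sKernel s (z, 0) * ENNReal.ofReal (2 * min 1 ‖z‖) =
      ENNReal.ofReal (g ‖z‖) := by
    intro z
    simp only [sKernel, hg, sub_zero]
    rw [← ENNReal.ofReal_mul (by positivity)]
  simp_rw [e]
  have hint : Integrable (fun z : Plane => g ‖z‖) := by
    rw [integrable_fun_norm_addHaar, finrank_euclideanSpace_fin,
      ← Set.Ioc_union_Ioi_eq_Ioi (zero_le_one' ℝ)]
    refine IntegrableOn.union ?_ ?_
    · have h1 : IntegrableOn (fun r : ℝ => 2 * r ^ (-(2 * s))) (Set.Ioc 0 1) := by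
        rw [integrableOn_Ioc_iff_integrableOn_Ioo]
        exact ((intervalIntegral.integrableOn_Ioo_rpow_iff one_pos).2 (by linarith)).const_mul 2
      refine h1.congr_fun (fun r hr => ?_) measurableSet_Ioc
      have hr0 : 0 < r := hr.1
      simp only [hg, min_eq_right hr.2, smul_eq_mul]
      rw [Real.rpow_add hr0, Real.rpow_natCast, Real.rpow_neg hr0.le]
      field_simp
      norm_num
    · have h1 : IntegrableOn (fun r : ℝ => 2 * r ^ (-(1 + 2 * s))) (Set.Ioi 1) :=
        (integrableOn_Ioi_rpow_of_lt (by linarith) one_pos).const_mul 2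
      refine h1.congr_fun (fun r hr => ?_) measurableSet_Ioi
      have hr1 : 1 < r := hr
      have hr0 : 0 < r := by linarith
      simp only [hg, min_eq_left hr1.le, smul_eq_mul]
      rw [Real.rpow_add hr0, Real.rpow_natCast, Real.rpow_neg hr0.le, Real.rpow_add hr0,
        Real.rpow_one]
      field_simp
      norm_num
  exact hint.lintegral_lt_top.ne

/-- With `x = z + y` and the integral in `y` taken first, the kernel at `z` is weighted by the area
of the points that `z` moves out of the disc, which compensates part of the singularity at `z = 0`.
-/
theorem sInteraction_compl_ball_ne_top {s : ℝ} (hs0 : 0 < s) (hs1 : s < 1 / 2) :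
    sInteraction s (Metric.ball (0 : Plane) 1)ᶜ (Metric.ball 0 1) ≠ ⊤ := by
  set B := Metric.ball (0 : Plane) 1 with hB
  have hBm : MeasurableSet B := measurableSet_ball
  set G : Plane × Plane → ENNReal := (Bᶜ ×ˢ B).indicator (sKernel s) with hG
  have hGm : Measurable G := (measurable_sKernel s).indicator (hBm.compl.prod hBm)
  have hpt : ∀ z : Plane, ∫⁻ y, G (z + y, y) ≤
      sKernel s (z, 0) * ENNReal.ofReal (2 * min 1 ‖z‖) * volume B := by
    intro z
    have e : ∀ y, G (z + y, y) ≤ {y | y ∈ B ∧ z + y ∉ B}.indicator (fun _ => sKernel s (z, 0)) y := by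
      intro y
      by_cases hy : y ∈ B ∧ z + y ∉ B
      · rw [Set.indicator_of_mem (show y ∈ {y | y ∈ B ∧ z + y ∉ B} from hy)]
        refine (Set.indicator_le_self _ _ _).trans ?_
        simp [sKernel]
      · rw [hG, Set.indicator_of_notMem (fun h => hy ⟨h.2, h.1⟩)]
        exact zero_le
    calc ∫⁻ y, G (z + y, y) ≤ ∫⁻ y, {y | y ∈ B ∧ z + y ∉ B}.indicator
          (fun _ => sKernel s (z, 0)) y := lintegral_mono e
      _ ≤ sKernel s (z, 0) * volume {y | y ∈ B ∧ z + y ∉ B} := lintegral_indicator_const_le _ _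
      _ ≤ _ := by
        rw [mul_assoc]
        gcongr
        exact volume_ball_diff_le z
  have hle : sInteraction s Bᶜ B ≤
      (∫⁻ z : Plane, sKernel s (z, 0) * ENNReal.ofReal (2 * min 1 ‖z‖)) * volume B := by
    rw [sInteraction_eq, ← lintegral_indicator (hBm.compl.prod hBm), ← hG, Measure.volume_eq_prod,
      lintegral_prod_symm _ hGm.aemeasurable]
    calc ∫⁻ y, ∫⁻ x, G (x, y) = ∫⁻ y, ∫⁻ z, G (z + y, y) := by
          congr 1; ext y
          exact (lintegral_add_right_eq_self (fun x => G (x, y)) y).symm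
      _ = ∫⁻ z, ∫⁻ y, G (z + y, y) :=
          lintegral_lintegral_swap (f := fun y z => G (z + y, y))
            (hGm.comp (by fun_prop : Measurable fun p : Plane × Plane => (p.2 + p.1, p.1))).aemeasurable
      _ ≤ ∫⁻ z, sKernel s (z, 0) * ENNReal.ofReal (2 * min 1 ‖z‖) * volume B := lintegral_mono hpt
      _ = _ := by
          rw [lintegral_mul_const']
          exact measure_ball_lt_top.ne
  exact ne_top_of_le_ne_top
    (ENNReal.mul_ne_top (lintegral_kernel_mul_min_ne_top hs0 hs1) measure_ball_lt_top.ne) hle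

/-- The measure on pairs scales by `R ^ 4` and the kernel by `R ^ (-(2 + 2s))`. -/
theorem sInteraction_compl_ball_scale (s : ℝ) {R : ℝ} (hR : 0 < R) :
    sInteraction s (Metric.ball (0 : Plane) R)ᶜ (Metric.ball 0 R) =
      ENNReal.ofReal (R ^ (2 - 2 * s)) *
        sInteraction s (Metric.ball (0 : Plane) 1)ᶜ (Metric.ball 0 1) := by
  have hm : ∀ r : ℝ, MeasurableSet ((Metric.ball (0 : Plane) r)ᶜ ×ˢ Metric.ball (0 : Plane) r) :=
    fun r => measurableSet_ball.compl.prod measurableSet_ball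
  set G : ℝ → Plane × Plane → ENNReal := fun r =>
    ((Metric.ball (0 : Plane) r)ᶜ ×ˢ Metric.ball (0 : Plane) r).indicator (sKernel s) with hG
  have hGm : ∀ r, Measurable (G r) := fun r => (measurable_sKernel s).indicator (hm r)
  have hR4 : 0 < R ^ 4 := by positivity
  have hsc : ∀ p, G R (R • p) = ENNReal.ofReal (R ^ (-(2 + 2 * s))) * G 1 p := by
    rintro ⟨x, y⟩
    have hmem : ∀ v : Plane, R • v ∈ Metric.ball (0 : Plane) R ↔ v ∈ Metric.ball (0 : Plane) 1 := by
      intro v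
      rw [mem_ball_zero_iff, mem_ball_zero_iff, norm_smul, Real.norm_of_nonneg hR.le]
      exact mul_lt_iff_lt_one_right hR
    by_cases h : (x, y) ∈ (Metric.ball (0 : Plane) 1)ᶜ ×ˢ Metric.ball (0 : Plane) 1
    · have h' : R • (x, y) ∈ (Metric.ball (0 : Plane) R)ᶜ ×ˢ Metric.ball (0 : Plane) R :=
        ⟨fun hx => h.1 ((hmem x).1 hx), (hmem y).2 h.2⟩
      simp only [hG]
      rw [Set.indicator_of_mem h, Set.indicator_of_mem h', sKernel, sKernel,
        ← ENNReal.ofReal_mul (by positivity)]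
      simp only [Prod.smul_mk, ← smul_sub, norm_smul, Real.norm_of_nonneg hR.le]
      rw [Real.mul_rpow hR.le (norm_nonneg _), Real.rpow_neg hR.le]
      congr 1
      push_cast
      field_simp
    · have h' : R • (x, y) ∉ (Metric.ball (0 : Plane) R)ᶜ ×ˢ Metric.ball (0 : Plane) R :=
        fun hx => h ⟨fun h1 => hx.1 ((hmem x).2 h1), (hmem y).1 hx.2⟩
      simp only [hG]
      rw [Set.indicator_of_notMem h, Set.indicator_of_notMem h', mul_zero]
  have : (volume : Measure (Plane × Plane)).IsAddHaarMeasure :=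
    Measure.prod.instIsAddHaarMeasure volume volume
  have hmap := Measure.map_addHaar_smul (volume : Measure (Plane × Plane)) hR.ne'
  rw [Module.finrank_prod, finrank_euclideanSpace_fin] at hmap
  have e : ∫⁻ p, G R (R • p) = ENNReal.ofReal (R ^ 4)⁻¹ * ∫⁻ p, G R p := by
    rw [← lintegral_map (hGm R) (measurable_const_smul R), hmap, lintegral_smul_measure,
      abs_of_pos (by positivity)]
    rfl
  simp_rw [hsc] at e
  rw [lintegral_const_mul _ (hGm 1)] at e
  rw [sInteraction_eq, sInteraction_eq, ← lintegral_indicator (hm R), ← lintegral_indicator (hm 1)]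
  calc ∫⁻ p, G R p = ENNReal.ofReal (R ^ 4) * (ENNReal.ofReal (R ^ 4)⁻¹ * ∫⁻ p, G R p) := by
        rw [← mul_assoc, ← ENNReal.ofReal_mul hR4.le, mul_inv_cancel₀ hR4.ne', ENNReal.ofReal_one,
          one_mul]
    _ = ENNReal.ofReal (R ^ (2 - 2 * s)) * ∫⁻ p, G 1 p := by
        rw [← e, ← mul_assoc, ← ENNReal.ofReal_mul hR4.le, ← Real.rpow_natCast,
          ← Real.rpow_add hR]
        congr 3
        push_cast; ring

/-- A minimizer in a ball has perimeter at most that of removing the ball. -/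
theorem IsSMinimizer.sPerimeter_le {s R : ℝ} {E : Set Plane}
    (h : IsSMinimizer s E (Metric.ball 0 R)) :
    sPerimeter s E (Metric.ball 0 R) ≤
      sInteraction s (Metric.ball (0 : Plane) R)ᶜ (Metric.ball 0 R) := by
  refine (h.le (E \ Metric.ball 0 R) (h.nullMeasurableSet.diff
    measurableSet_ball.nullMeasurableSet) (by simp)).trans ?_
  have e1 : (E \ Metric.ball 0 R) ∩ Metric.ball 0 R = ∅ := by
    ext; simp
  rw [sPerimeter, e1]
  simp only [sInteraction_eq, Set.empty_prod, Measure.restrict_empty, lintegral_zero_measure,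
    zero_add]
  exact lintegral_mono_set (Set.prod_mono (fun x hx => hx.1.2) Set.inter_subset_right)

/-! ### Deformations and change of variables. -/

/-- The deformation `x ↦ x + φ x • w`. -/
noncomputable def deform (φ : Plane → ℝ) (w x : Plane) : Plane := x + φ x • w

section Deform

variable {φ : Plane → ℝ} {w : Plane} {L : ℝ}

theorem norm_smul_sub_smul_le (hL : ∀ x y, |φ x - φ y| ≤ L * ‖x - y‖) (w x y : Plane) :
    ‖φ x • w - φ y • w‖ ≤ L * ‖w‖ * ‖x - y‖ := by
  rw [← sub_smul, norm_smul, Real.norm_eq_abs]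
  nlinarith [hL x y, norm_nonneg w]

/-- The deformation is the identity plus a map with Lipschitz constant at most 1/2. The same fact
gives surjectivity, a preimage of `y` being a fixed point of the contraction `z ↦ y - φ z • w`. -/
theorem deform_injective (hL : ∀ x y, |φ x - φ y| ≤ L * ‖x - y‖) (hw : L * ‖w‖ ≤ 1 / 2) :
    Function.Injective (deform φ w) := by
  intro x y hxy
  have h1 : x - y = -(φ x • w - φ y • w) := by
    unfold deform at hxy
    rw [neg_sub, sub_eq_sub_iff_add_eq_add, hxy, add_comm]
  have h2 := norm_smul_sub_smul_le hL w x y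
  rw [← norm_neg (φ x • w - φ y • w), ← h1] at h2
  have h3 : ‖x - y‖ ≤ 0 := by nlinarith [norm_nonneg (x - y)]
  exact sub_eq_zero.1 (norm_le_zero_iff.1 h3)

theorem deform_surjective (hL : ∀ x y, |φ x - φ y| ≤ L * ‖x - y‖) (hw : L * ‖w‖ ≤ 1 / 2) :
    Function.Surjective (deform φ w) := by
  intro y
  have hc : ContractingWith (1 / 2) fun z => y - φ z • w := by
    refine ⟨by
      rw [← NNReal.coe_lt_coe]; norm_num, LipschitzWith.of_dist_le_mul fun a b => ?_⟩
    rw [dist_eq_norm, dist_eq_norm, sub_sub_sub_cancel_left, norm_sub_rev]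
    refine (norm_smul_sub_smul_le hL w a b).trans ?_
    push_cast
    gcongr
  refine ⟨hc.fixedPoint, ?_⟩
  have := hc.fixedPoint_isFixedPt
  rw [Function.IsFixedPt, sub_eq_iff_eq_add] at this
  exact this.symm

theorem hasFDerivAt_deform (hφ : ContDiff ℝ 1 φ) (w x : Plane) :
    HasFDerivAt (deform φ w)
      (ContinuousLinearMap.id ℝ Plane + (fderiv ℝ φ x).smulRight w) x :=
  (hasFDerivAt_id x).add ((hφ.differentiable one_ne_zero x).hasFDerivAt.smul_const w)

theorem det_id_add_smulRight (f : Plane →L[ℝ] ℝ) (w : Plane) :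
    (ContinuousLinearMap.id ℝ Plane + f.smulRight w).det = 1 + f w :=
  LinearMap.transvection.det (f : Module.Dual ℝ Plane) w

theorem abs_fderiv_apply_le (hL : ∀ x y, |φ x - φ y| ≤ L * ‖x - y‖) (w x : Plane) :
    |fderiv ℝ φ x w| ≤ L * ‖w‖ := by
  have hL0 : 0 ≤ L := by
    obtain ⟨v, hv⟩ := exists_ne (0 : Plane)
    have := (abs_nonneg _).trans (hL v 0)
    rw [sub_zero] at this
    exact nonneg_of_mul_nonneg_left this (norm_pos_iff.2 hv)
  exact (fderiv ℝ φ x).le_of_opNorm_le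
    (norm_fderiv_le_of_lip' ℝ hL0 (Filter.Eventually.of_forall fun y => hL y x)) w

theorem continuous_deform (hφ : ContDiff ℝ 1 φ) (w : Plane) : Continuous (deform φ w) :=
  continuous_id.add (hφ.continuous.smul continuous_const)

theorem lintegral_deform (hφ : ContDiff ℝ 1 φ) (hL : ∀ x y, |φ x - φ y| ≤ L * ‖x - y‖)
    (hw : L * ‖w‖ ≤ 1 / 2) (g : Plane → ENNReal) :
    ∫⁻ x, g x = ∫⁻ x, ENNReal.ofReal (1 + fderiv ℝ φ x w) * g (deform φ w x) := by
  have h := lintegral_image_eq_lintegral_abs_det_fderiv_mul volume MeasurableSet.univ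
    (fun x _ => (hasFDerivAt_deform hφ w x).hasFDerivWithinAt)
    (deform_injective hL hw).injOn g
  rw [Set.image_univ, (deform_surjective hL hw).range_eq, Measure.restrict_univ] at h
  rw [h]
  congr 1; ext x
  rw [det_id_add_smulRight, abs_of_nonneg]
  have := abs_le.1 (abs_fderiv_apply_le hL w x)
  linarith

theorem measurable_jacobian (φ : Plane → ℝ) (w : Plane) :
    Measurable fun x => ENNReal.ofReal (1 + fderiv ℝ φ x w) :=
  ((measurable_fderiv_apply_const ℝ φ w).const_add 1).ennreal_ofReal

theorem lintegral_prod_deform (hφ : ContDiff ℝ 1 φ) (hL : ∀ x y, |φ x - φ y| ≤ L * ‖x - y‖)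
    (hw : L * ‖w‖ ≤ 1 / 2) {G : Plane × Plane → ENNReal} (hG : Measurable G) :
    ∫⁻ p, G p = ∫⁻ p : Plane × Plane, ENNReal.ofReal (1 + fderiv ℝ φ p.1 w) *
      (ENNReal.ofReal (1 + fderiv ℝ φ p.2 w) * G (deform φ w p.1, deform φ w p.2)) := by
  have hJ := measurable_jacobian φ w
  have hd := (continuous_deform hφ w).measurable
  have hm : Measurable fun p : Plane × Plane => ENNReal.ofReal (1 + fderiv ℝ φ p.1 w) *
      (ENNReal.ofReal (1 + fderiv ℝ φ p.2 w) * G (deform φ w p.1, deform φ w p.2)) :=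
    (hJ.comp measurable_fst).mul ((hJ.comp measurable_snd).mul
      (hG.comp ((hd.comp measurable_fst).prodMk (hd.comp measurable_snd))))
  rw [Measure.volume_eq_prod, lintegral_prod _ hG.aemeasurable, lintegral_prod _ hm.aemeasurable,
    lintegral_deform hφ hL hw fun x => ∫⁻ y, G (x, y)]
  congr 1; ext x
  dsimp only
  rw [lintegral_const_mul']
  · rw [lintegral_deform hφ hL hw fun y => G (deform φ w x, y)]
  · exact ENNReal.ofReal_ne_top

end Deform

/-! ### Submodularity and second variation of the perimeter. -/

/-- The pairs of points whose interaction counts in the perimeter of `E` in `Ω`. -/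
def perimeterPairs (E Ω : Set Plane) : Set (Plane × Plane) := (E ×ˢ Eᶜ) \ (Ωᶜ ×ˢ Ωᶜ)

theorem measurableSet_perimeterPairs {E Ω : Set Plane} (hE : MeasurableSet E)
    (hΩ : MeasurableSet Ω) : MeasurableSet (perimeterPairs E Ω) :=
  (hE.prod hE.compl).diff (hΩ.compl.prod hΩ.compl)

theorem sPerimeter_eq (s : ℝ) {E Ω : Set Plane} (hE : MeasurableSet E) (hΩ : MeasurableSet Ω) :
    sPerimeter s E Ω = ∫⁻ p in perimeterPairs E Ω, sKernel s p := by
  have e : perimeterPairs E Ω = ((E ∩ Ω) ×ˢ (Eᶜ ∩ Ω) ∪ (E ∩ Ω) ×ˢ (Eᶜ \ Ω)) ∪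
      (E \ Ω) ×ˢ (Eᶜ ∩ Ω) := by
    ext ⟨x, y⟩
    simp only [perimeterPairs, Set.mem_sdiff, Set.mem_prod, Set.mem_union, Set.mem_inter_iff,
      Set.mem_compl_iff]
    tauto
  rw [e, lintegral_union ((hE.diff hΩ).prod (hE.compl.inter hΩ)),
    lintegral_union ((hE.inter hΩ).prod (hE.compl.diff hΩ))]
  · rfl
  · rw [Set.disjoint_left]
    rintro ⟨x, y⟩ h1 h2
    exact h2.2.2 h1.2.2
  · rw [Set.disjoint_left]
    rintro ⟨x, y⟩ h1 h2
    rcases h1 with h1 | h1 <;> exact h2.1.2 h1.1.2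

/-- Submodularity of the `s`-perimeter, with the interaction of the differences as defect. -/
theorem sPerimeter_union_add_inter_le (s : ℝ) {E F Ω B : Set Plane} (hE : MeasurableSet E)
    (hF : MeasurableSet F) (hΩ : MeasurableSet Ω) (hB : MeasurableSet B) (hBΩ : B ⊆ Ω) :
    sPerimeter s (E ∪ F) Ω + sPerimeter s (E ∩ F) Ω +
      sInteraction s ((E \ F) ∩ B) ((F \ E) ∩ B) ≤ sPerimeter s E Ω + sPerimeter s F Ω := by
  set ν := (volume : Measure (Plane × Plane)).withDensity (sKernel s) with hν
  have hP : ∀ {G : Set Plane}, MeasurableSet G → sPerimeter s G Ω = ν (perimeterPairs G Ω) :=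
    fun hG => by
      rw [sPerimeter_eq s hG hΩ, hν, withDensity_apply _ (measurableSet_perimeterPairs hG hΩ)]
  have hD : MeasurableSet (((E \ F) ∩ B) ×ˢ ((F \ E) ∩ B)) :=
    ((hE.diff hF).inter hB).prod ((hF.diff hE).inter hB)
  rw [hP (hE.union hF), hP (hE.inter hF), hP hE, hP hF, sInteraction_eq,
    ← withDensity_apply _ hD, ← hν,
    ← measure_union_add_inter (perimeterPairs (E ∪ F) Ω)
      (measurableSet_perimeterPairs (hE.inter hF) hΩ),
    ← measure_union_add_inter (perimeterPairs E Ω) (measurableSet_perimeterPairs hF hΩ),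
    add_right_comm]
  -- The pairs counted twice are the same on both sides, so unions of pair sets can be compared. A
  -- pair in `(E \ F) × (F \ E)` counts for `E` but for neither `E ∪ F` nor `E ∩ F`, which produces
  -- the defect.
  have e1 : perimeterPairs (E ∪ F) Ω ∩ perimeterPairs (E ∩ F) Ω =
      perimeterPairs E Ω ∩ perimeterPairs F Ω := by
    ext ⟨x, y⟩
    simp only [perimeterPairs, Set.mem_sdiff, Set.mem_prod, Set.mem_union, Set.mem_inter_iff,
      Set.mem_compl_iff]
    tauto
  rw [e1, ← measure_union _ hD]
  · refine add_le_add (measure_mono ?_) le_rfl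
    rintro ⟨x, y⟩ h
    have := @hBΩ x
    simp only [perimeterPairs, Set.mem_sdiff, Set.mem_prod, Set.mem_union, Set.mem_inter_iff,
      Set.mem_compl_iff] at h ⊢
    tauto
  · rw [Set.disjoint_left]
    rintro ⟨x, y⟩ h1 h2
    simp only [perimeterPairs, Set.mem_sdiff, Set.mem_prod, Set.mem_union, Set.mem_inter_iff,
      Set.mem_compl_iff] at h1 h2
    tauto

section Deform

variable {φ : Plane → ℝ} {w : Plane} {L : ℝ} {Ω : Set Plane}

theorem deform_of_notMem (hφ0 : ∀ x ∉ Ω, φ x = 0) {x : Plane} (hx : x ∉ Ω) :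
    deform φ w x = x := by simp [deform, hφ0 x hx]

/-- Points outside `Ω` are fixed, so by injectivity no point of `Ω` can land on one of them. -/
theorem deform_mem_iff (hL : ∀ x y, |φ x - φ y| ≤ L * ‖x - y‖) (hw : L * ‖w‖ ≤ 1 / 2)
    (hφ0 : ∀ x ∉ Ω, φ x = 0) (x : Plane) : deform φ w x ∈ Ω ↔ x ∈ Ω := by
  constructor
  · intro h
    by_contra hx
    rw [deform_of_notMem hφ0 hx] at h
    exact hx h
  · intro hx
    by_contra h
    have := deform_injective hL hw (deform_of_notMem (w := w) hφ0 h)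
    rw [this] at h
    exact h hx

theorem deform_image_sdiff (hL : ∀ x y, |φ x - φ y| ≤ L * ‖x - y‖) (hw : L * ‖w‖ ≤ 1 / 2)
    (hφ0 : ∀ x ∉ Ω, φ x = 0) (E : Set Plane) : (deform φ w '' E) \ Ω = E \ Ω := by
  ext x
  constructor
  · rintro ⟨⟨y, hy, rfl⟩, hx⟩
    have hy' : y ∉ Ω := fun h => hx ((deform_mem_iff hL hw hφ0 y).2 h)
    rw [deform_of_notMem hφ0 hy']
    exact ⟨hy, hy'⟩
  · rintro ⟨hx, hxΩ⟩
    exact ⟨⟨x, hx, deform_of_notMem hφ0 hxΩ⟩, hxΩ⟩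

theorem measurableSet_deform_image (hφ : ContDiff ℝ 1 φ)
    (hL : ∀ x y, |φ x - φ y| ≤ L * ‖x - y‖) (hw : L * ‖w‖ ≤ 1 / 2) {E : Set Plane}
    (hE : MeasurableSet E) : MeasurableSet (deform φ w '' E) :=
  hE.image_of_continuousOn_injOn (continuous_deform hφ w).continuousOn
    (deform_injective hL hw).injOn

/-- The deformation is a bijection preserving `Ω`, so it carries the perimeter pairs of `E` to those
of the image. The integral over the image is thus pulled back to the fixed domain of `E`, where
opposite deformations can be compared pointwise. -/
theorem sPerimeter_deform (s : ℝ) (hφ : ContDiff ℝ 1 φ)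
    (hL : ∀ x y, |φ x - φ y| ≤ L * ‖x - y‖) (hw : L * ‖w‖ ≤ 1 / 2) (hφ0 : ∀ x ∉ Ω, φ x = 0)
    {E : Set Plane} (hE : MeasurableSet E) (hΩ : MeasurableSet Ω) :
    sPerimeter s (deform φ w '' E) Ω = ∫⁻ p in perimeterPairs E Ω,
      ENNReal.ofReal (1 + fderiv ℝ φ p.1 w) * (ENNReal.ofReal (1 + fderiv ℝ φ p.2 w) *
        sKernel s (deform φ w p.1, deform φ w p.2)) := by
  have hE' := measurableSet_deform_image hφ hL hw hE
  have hi := deform_injective hL hw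
  have hmem : ∀ p : Plane × Plane, (deform φ w p.1, deform φ w p.2) ∈
      perimeterPairs (deform φ w '' E) Ω ↔ p ∈ perimeterPairs E Ω := by
    rintro ⟨x, y⟩
    simp only [perimeterPairs, Set.mem_sdiff, Set.mem_prod, Set.mem_compl_iff,
      deform_mem_iff hL hw hφ0, hi.mem_set_image]
  have hm := measurableSet_perimeterPairs hE hΩ
  have hm' := measurableSet_perimeterPairs hE' hΩ
  rw [sPerimeter_eq s hE' hΩ, ← lintegral_indicator hm',
    lintegral_prod_deform hφ hL hw ((measurable_sKernel s).indicator hm'),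
    ← lintegral_indicator hm]
  congr 1; ext p
  by_cases hp : p ∈ perimeterPairs E Ω
  · rw [Set.indicator_of_mem hp, Set.indicator_of_mem ((hmem p).2 hp)]
  · rw [Set.indicator_of_notMem hp, Set.indicator_of_notMem (mt (hmem p).1 hp)]
    simp

/-- The second variation of the perimeter along `x ↦ x ± φ x • w` is controlled by the
perimeter. -/
theorem sPerimeter_deform_add_le {s : ℝ} (hs0 : 0 < s) (hs1 : s < 1 / 2) (hφ : ContDiff ℝ 1 φ)
    (hL : ∀ x y, |φ x - φ y| ≤ L * ‖x - y‖) (hw : L * ‖w‖ ≤ 1 / 2) (hφ0 : ∀ x ∉ Ω, φ x = 0)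
    {E : Set Plane} (hE : MeasurableSet E) (hΩ : MeasurableSet Ω) :
    sPerimeter s (deform φ w '' E) Ω + sPerimeter s (deform φ (-w) '' E) Ω ≤
      ENNReal.ofReal (2 + 1100 * (L * ‖w‖) ^ 2) * sPerimeter s E Ω := by
  have hw' : L * ‖-w‖ ≤ 1 / 2 := by rwa [norm_neg]
  have hm := measurableSet_perimeterPairs hE hΩ
  have hmeas : ∀ v : Plane, Measurable fun p : Plane × Plane =>
      ENNReal.ofReal (1 + fderiv ℝ φ p.1 v) * (ENNReal.ofReal (1 + fderiv ℝ φ p.2 v) *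
        sKernel s (deform φ v p.1, deform φ v p.2)) := fun v =>
    ((measurable_jacobian φ v).comp measurable_fst).mul
      (((measurable_jacobian φ v).comp measurable_snd).mul ((measurable_sKernel s).comp
        (((continuous_deform hφ v).measurable.comp measurable_fst).prodMk
          ((continuous_deform hφ v).measurable.comp measurable_snd))))
  rw [sPerimeter_deform s hφ hL hw hφ0 hE hΩ, sPerimeter_deform s hφ hL hw' hφ0 hE hΩ,
    sPerimeter_eq s hE hΩ, ← lintegral_add_left (hmeas w),
    ← lintegral_const_mul _ (measurable_sKernel s)]
  refine setLIntegral_mono ((measurable_sKernel s).const_mul _) ?_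
  rintro ⟨x, y⟩ hp
  have hxy : x - y ≠ 0 := by
    rintro h
    rw [sub_eq_zero] at h
    exact hp.1.2 (h ▸ hp.1.1)
  have hα := abs_fderiv_apply_le hL w x
  have hβ := abs_fderiv_apply_le hL w y
  obtain ⟨a1, a2⟩ := abs_le.1 hα
  obtain ⟨b1, b2⟩ := abs_le.1 hβ
  have key := kernel_second_difference hs0 hs1 (v := w) hxy (d := φ x - φ y) hw
    (by nlinarith [hL x y, norm_nonneg w]) hα hβ
  have e1 : deform φ w x - deform φ w y = x - y + (φ x - φ y) • w := by
    simp only [deform, sub_smul]; abel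
  have e2 : deform φ (-w) x - deform φ (-w) y = x - y - (φ x - φ y) • w := by
    simp only [deform, sub_smul, smul_neg]; abel
  simp only [sKernel, e1, e2, map_neg, ← sub_eq_add_neg, Nat.cast_ofNat]
  rw [← ENNReal.ofReal_mul (by linarith), ← ENNReal.ofReal_mul (by linarith),
    ← ENNReal.ofReal_mul (by linarith), ← ENNReal.ofReal_mul (by linarith),
    ← ENNReal.ofReal_mul (by positivity), ← ENNReal.ofReal_add]
  · refine ENNReal.ofReal_le_ofReal (le_trans (le_of_eq ?_) key)
    ring
  · exact mul_nonneg (by linarith) (mul_nonneg (by linarith) (by positivity))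
  · exact mul_nonneg (by linarith) (mul_nonneg (by linarith) (by positivity))

/-- For a minimizer, the two differences with a deformed copy interact weakly. -/
theorem IsSMinimizer.sInteraction_deform_le {s : ℝ} (hs0 : 0 < s) (hs1 : s < 1 / 2)
    {E B : Set Plane} (h : IsSMinimizer s E Ω) (hE : MeasurableSet E) (hΩ : MeasurableSet Ω)
    (hB : MeasurableSet B) (hBΩ : B ⊆ Ω) (hfin : sPerimeter s E Ω ≠ ⊤) (hφ : ContDiff ℝ 1 φ)
    (hL : ∀ x y, |φ x - φ y| ≤ L * ‖x - y‖) (hw : L * ‖w‖ ≤ 1 / 2) (hφ0 : ∀ x ∉ Ω, φ x = 0) :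
    sInteraction s ((E \ deform φ w '' E) ∩ B) ((deform φ w '' E \ E) ∩ B) ≤
      ENNReal.ofReal (1100 * (L * ‖w‖) ^ 2) * sPerimeter s E Ω := by
  have hw' : L * ‖-w‖ ≤ 1 / 2 := by rwa [norm_neg]
  set F := deform φ w '' E with hF
  have hFm : MeasurableSet F := measurableSet_deform_image hφ hL hw hE
  have hFd : F \ Ω = E \ Ω := deform_image_sdiff hL hw hφ0 E
  have h1 := h.le (E ∪ F) (hE.union hFm).nullMeasurableSet (by
    rw [Set.union_sdiff_distrib, hFd, Set.union_self])
  have h2 := h.le (E ∩ F) (hE.inter hFm).nullMeasurableSet (by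
    rw [show (E ∩ F) \ Ω = (E \ Ω) ∩ (F \ Ω) by ext x; simp; tauto, hFd, Set.inter_self])
  have h3 := h.le _ (measurableSet_deform_image hφ hL hw' hE).nullMeasurableSet
    (deform_image_sdiff hL hw' hφ0 E)
  have h4 := sPerimeter_union_add_inter_le s hE hFm hΩ hB hBΩ
  have h5 := sPerimeter_deform_add_le hs0 hs1 hφ hL hw hφ0 hE hΩ
  set P := sPerimeter s E Ω with hP
  -- Minimality against `E ∪ F` and `E ∩ F` shows that `F` exceeds the minimum by at least the
  -- defect. The opposite deformation costs at least `P`, so the second variation bounds the defect;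
  -- cancelling `P` requires it to be finite.
  have h6 : P + P + sInteraction s ((E \ F) ∩ B) ((F \ E) ∩ B) ≤
      P + sPerimeter s F Ω := le_trans (by gcongr) h4
  have h7 : P + sInteraction s ((E \ F) ∩ B) ((F \ E) ∩ B) ≤ sPerimeter s F Ω := by
    rw [add_assoc] at h6
    exact (ENNReal.add_le_add_iff_left hfin).1 h6
  have h8 : P + P + sInteraction s ((E \ F) ∩ B) ((F \ E) ∩ B) ≤
      P + P + ENNReal.ofReal (1100 * (L * ‖w‖) ^ 2) * P := by
    calc P + P + sInteraction s ((E \ F) ∩ B) ((F \ E) ∩ B)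
        = P + sInteraction s ((E \ F) ∩ B) ((F \ E) ∩ B) + P := by ring
      _ ≤ sPerimeter s F Ω + sPerimeter s (deform φ (-w) '' E) Ω := add_le_add h7 h3
      _ ≤ _ := h5
      _ = _ := by
        rw [ENNReal.ofReal_add (by norm_num) (by positivity), ENNReal.ofReal_ofNat]
        ring
  exact (ENNReal.add_le_add_iff_left (ENNReal.add_ne_top.2 ⟨hfin, hfin⟩)).1 h8

end Deform

/-! ### Crossing bounds for minimizers in large balls. -/

/-- All cutoffs are rescalings of one bump function, so that `L` does not depend on `R`. -/
theorem exists_cutoff : ∃ L : ℝ, 0 < L ∧ ∀ R : ℝ, 0 < R → ∃ φ : Plane → ℝ, ContDiff ℝ 1 φ ∧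
    (∀ x, ‖x‖ ≤ R / 2 → φ x = 1) ∧ (∀ x ∉ Metric.ball (0 : Plane) R, φ x = 0) ∧
    ∀ x y, |φ x - φ y| ≤ L / R * ‖x - y‖ := by
  let b : ContDiffBump (0 : Plane) := ⟨1 / 2, 1, by norm_num, by norm_num⟩
  have hb : ContDiff ℝ 1 b := b.contDiff
  obtain ⟨K, hK⟩ := hb.lipschitzWith_of_hasCompactSupport b.hasCompactSupport one_ne_zero
  refine ⟨K + 1, by positivity, fun R hR => ⟨fun x => b (R⁻¹ • x), ?_, ?_, ?_, ?_⟩⟩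
  · exact hb.comp (contDiff_const_smul _)
  · intro x hx
    refine b.one_of_mem_closedBall ?_
    rw [mem_closedBall_zero_iff, norm_smul, norm_inv, Real.norm_of_nonneg hR.le,
      inv_mul_le_iff₀ hR]
    change ‖x‖ ≤ R * (1 / 2)
    linarith
  · intro x hx
    refine b.zero_of_le_dist ?_
    rw [mem_ball_zero_iff, not_lt] at hx
    rw [dist_zero_right, norm_smul, norm_inv, Real.norm_of_nonneg hR.le, le_inv_mul_iff₀ hR]
    change R * 1 ≤ ‖x‖
    linarith
  · intro x y
    have := hK.dist_le_mul (R⁻¹ • x) (R⁻¹ • y)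
    rw [Real.dist_eq, dist_eq_norm, ← smul_sub, norm_smul, norm_inv,
      Real.norm_of_nonneg hR.le] at this
    refine this.trans ?_
    rw [← mul_assoc, ← div_eq_mul_inv]
    gcongr
    linarith

theorem le_sInteraction_of_subset_ball {s : ℝ} (hs0 : 0 < s) {S₁ S₂ : Set Plane} {r : ℝ}
    (hm₁ : MeasurableSet S₁) (hm₂ : MeasurableSet S₂) (h₁ : S₁ ⊆ Metric.ball 0 r)
    (h₂ : S₂ ⊆ Metric.ball 0 r) (hd : Disjoint S₁ S₂) :
    ENNReal.ofReal (1 / (2 * r) ^ (2 + 2 * s)) * (volume S₁ * volume S₂) ≤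
      sInteraction s S₁ S₂ := by
  rw [sInteraction_eq, ← Measure.prod_prod, ← Measure.volume_eq_prod, ← setLIntegral_const]
  refine setLIntegral_mono' (hm₁.prod hm₂) ?_
  rintro ⟨x, y⟩ ⟨hx, hy⟩
  refine ENNReal.ofReal_le_ofReal ?_
  have hne : x - y ≠ 0 := fun h => by
    rw [sub_eq_zero] at h
    exact Set.disjoint_left.1 hd hx (by simpa [h] using hy)
  have hpos : 0 < ‖x - y‖ := norm_pos_iff.2 hne
  have hx' := mem_ball_zero_iff.1 (h₁ hx)
  have hy' := mem_ball_zero_iff.1 (h₂ hy)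
  have hle : ‖x - y‖ ≤ 2 * r := (norm_sub_le x y).trans (by linarith)
  push_cast
  gcongr

/-- In a large ball, each bounded translation of a minimizer either adds or removes little mass
near the origin. -/
theorem exists_crossing_bound {s : ℝ} (hs0 : 0 < s) (hs1 : s < 1 / 2) :
    ∃ C R₀ : ℝ, 0 < C ∧ 0 < R₀ ∧ ∀ R : ℝ, R₀ ≤ R → ∀ E : Set Plane, MeasurableSet E →
      IsSMinimizer s E (Metric.ball 0 R) → ∀ w : Plane, ‖w‖ ≤ 4 →
      volume ({x | x ∈ E ∧ x - w ∉ E} ∩ Metric.ball 0 14) ≤ ENNReal.ofReal (C / R ^ s) ∨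
      volume ({x | x ∉ E ∧ x - w ∈ E} ∩ Metric.ball 0 14) ≤ ENNReal.ofReal (C / R ^ s) := by
  obtain ⟨L, hL0, hcut⟩ := exists_cutoff
  set J := (sInteraction s (Metric.ball (0 : Plane) 1)ᶜ (Metric.ball 0 1)).toReal with hJ
  have hJ0 : 0 ≤ J := ENNReal.toReal_nonneg
  set k : ℝ := (2 * 14 : ℝ) ^ (2 + 2 * s) with hk
  have hk0 : 0 < k := by positivity
  -- The product of the two volumes is at most `D * R ^ (-2s)`, whence the square root of `D` below.
  -- The summand 1 ensures positivity.
  set D : ℝ := k * (1100 * (L * 4) ^ 2 * J) + 1 with hD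
  have hD0 : 0 < D := by positivity
  -- From `36 ≤ R`, a point of `B_14` moved by at most 4 stays in `B_18 ⊆ B_{R/2}`, where `φ = 1`.
  -- From `8 * L ≤ R`, the deformation has Lipschitz perturbation at most 1/2.
  refine ⟨√D, max 36 (8 * L), by positivity, by positivity, fun R hR E hE hmin w hw => ?_⟩
  have hR36 : 36 ≤ R := (le_max_left _ _).trans hR
  have hR8 : 8 * L ≤ R := (le_max_right _ _).trans hR
  have hR0 : 0 < R := by linarith
  obtain ⟨φ, hφ, hφ1, hφ0, hφL⟩ := hcut R hR0
  have hLw : L / R * ‖w‖ ≤ L * 4 / R := by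
    rw [div_mul_eq_mul_div]; gcongr
  have hLw2 : L / R * ‖w‖ ≤ 1 / 2 := hLw.trans (by rw [div_le_iff₀ hR0]; linarith)
  have hP : sPerimeter s E (Metric.ball 0 R) ≤ ENNReal.ofReal (R ^ (2 - 2 * s) * J) := by
    refine hmin.sPerimeter_le.trans (le_of_eq ?_)
    rw [sInteraction_compl_ball_scale s hR0, ENNReal.ofReal_mul (by positivity), hJ,
      ENNReal.ofReal_toReal (sInteraction_compl_ball_ne_top hs0 hs1)]
  have hfin := ne_top_of_le_ne_top ENNReal.ofReal_ne_top hP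
  have hFm := measurableSet_deform_image hφ hφL hLw2 hE
  have hI := hmin.sInteraction_deform_le (B := Metric.ball 0 14) hs0 hs1 hE measurableSet_ball
    measurableSet_ball (Metric.ball_subset_ball (by linarith)) hfin hφ hφL hLw2 hφ0
  set F := deform φ w '' E with hF
  have hmem : ∀ x ∈ Metric.ball (0 : Plane) 14, x ∈ F ↔ x - w ∈ E := by
    intro x hx
    rw [mem_ball_zero_iff] at hx
    have : deform φ w (x - w) = x := by
      rw [deform, hφ1 (x - w) ((norm_sub_le x w).trans (by linarith)), one_smul, sub_add_cancel]
    have hi := (deform_injective hφL hLw2).mem_set_image (s := E) (a := x - w)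
    rwa [this] at hi
  have e1 : (E \ F) ∩ Metric.ball 0 14 = {x | x ∈ E ∧ x - w ∉ E} ∩ Metric.ball 0 14 := by
    ext x
    constructor
    · rintro ⟨⟨h1, h2⟩, h3⟩
      exact ⟨⟨h1, fun h => h2 ((hmem x h3).2 h)⟩, h3⟩
    · rintro ⟨⟨h1, h2⟩, h3⟩
      exact ⟨⟨h1, fun h => h2 ((hmem x h3).1 h)⟩, h3⟩
  have e2 : (F \ E) ∩ Metric.ball 0 14 = {x | x ∉ E ∧ x - w ∈ E} ∩ Metric.ball 0 14 := by
    ext x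
    constructor
    · rintro ⟨⟨h1, h2⟩, h3⟩
      exact ⟨⟨h2, (hmem x h3).1 h1⟩, h3⟩
    · rintro ⟨⟨h1, h2⟩, h3⟩
      exact ⟨⟨(hmem x h3).2 h2, h1⟩, h3⟩
  have hlow := le_sInteraction_of_subset_ball (r := 14) hs0
    ((hE.diff hFm).inter measurableSet_ball) ((hFm.diff hE).inter measurableSet_ball)
    (Set.inter_subset_right) (Set.inter_subset_right)
    (Set.disjoint_left.2 fun x hx hy => hx.1.2 hy.1.1)
  rw [← hk] at hlow
  rw [e1, e2] at hI hlow
  by_contra hcon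
  push Not at hcon
  obtain ⟨c1, c2⟩ := hcon
  have hmul := ENNReal.mul_lt_mul c1 c2
  rw [← ENNReal.ofReal_mul (by positivity)] at hmul
  have hle := hlow.trans (hI.trans (mul_le_mul' le_rfl hP))
  rw [← ENNReal.ofReal_mul (by positivity)] at hle
  have hup := mul_le_mul_right hle (ENNReal.ofReal k)
  rw [← mul_assoc, ← ENNReal.ofReal_mul hk0.le, mul_one_div_cancel hk0.ne', ENNReal.ofReal_one,
    one_mul, ← ENNReal.ofReal_mul hk0.le] at hup
  have hfinal := hmul.trans_le hup
  refine absurd hfinal (not_lt.2 (ENNReal.ofReal_le_ofReal ?_))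
  have hRs : √D / R ^ s * (√D / R ^ s) = D * R ^ (-(2 * s)) := by
    rw [div_mul_div_comm, Real.mul_self_sqrt hD0.le, ← Real.rpow_add hR0, Real.rpow_neg hR0.le,
      div_eq_mul_inv]
    congr 3; ring
  have hR2 : R ^ (2 - 2 * s) = R ^ 2 * R ^ (-(2 * s)) := by
    rw [← Real.rpow_natCast, ← Real.rpow_add hR0]; congr 1
  have hsq : (L / R * ‖w‖) ^ 2 ≤ (L * 4) ^ 2 / R ^ 2 := by
    rw [← div_pow]
    exact pow_le_pow_left₀ (by positivity) hLw 2
  rw [hRs, hR2]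
  calc k * (1100 * (L / R * ‖w‖) ^ 2 * (R ^ 2 * R ^ (-(2 * s)) * J))
      ≤ k * (1100 * ((L * 4) ^ 2 / R ^ 2) * (R ^ 2 * R ^ (-(2 * s)) * J)) := by gcongr
    _ = k * (1100 * (L * 4) ^ 2 * J) * R ^ (-(2 * s)) := by field_simp
    _ ≤ D * R ^ (-(2 * s)) := by
        gcongr
        rw [hD]; linarith

/-! ### Invariance under modification on null sets. -/

theorem sPerimeter_congr_ae (s : ℝ) {E E' Ω : Set Plane}
    (h : E =ᵐ[volume] E') : sPerimeter s E Ω = sPerimeter s E' Ω := by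
  have hc := ae_eq_set_compl_compl.2 h
  have hI : ∀ {A A' B B' : Set Plane}, A =ᵐ[volume] A' → B =ᵐ[volume] B' →
      sInteraction s A B = sInteraction s A' B' := fun hA hB => by
    rw [sInteraction_eq, sInteraction_eq]
    exact setLIntegral_congr (Measure.set_prod_ae_eq hA hB)
  have r : Ω =ᵐ[volume] Ω := Filter.EventuallyEq.rfl
  unfold sPerimeter
  exact congrArg₂ _ (congrArg₂ _ (hI (ae_eq_set_inter h r) (ae_eq_set_inter hc r))
    (hI (ae_eq_set_inter h r) (ae_eq_set_sdiff hc r)))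
    (hI (ae_eq_set_sdiff h r) (ae_eq_set_inter hc r))

/-- A competitor `F` for `E'` need not agree with `E` outside `Ω`, but `F ∩ Ω ∪ E \ Ω` does and
differs from `F` by a null set. -/
theorem IsSMinimizer.congr_ae {s : ℝ} {E E' Ω : Set Plane} (hΩ : MeasurableSet Ω)
    (hm : IsSMinimizer s E Ω) (h : E =ᵐ[volume] E') : IsSMinimizer s E' Ω := by
  refine ⟨hm.nullMeasurableSet.congr h, fun F hF hFE => ?_⟩
  have hΩ' := hΩ.nullMeasurableSet (μ := volume)
  have r : Ω =ᵐ[volume] Ω := Filter.EventuallyEq.rfl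
  have e : (F ∩ Ω ∪ E \ Ω : Set Plane) =ᵐ[volume] F := by
    have h1 : (F ∩ Ω ∪ E \ Ω : Set Plane) =ᵐ[volume] (F ∩ Ω ∪ E' \ Ω : Set Plane) :=
      ae_eq_set_union Filter.EventuallyEq.rfl (ae_eq_set_sdiff h r)
    rwa [← hFE, Set.inter_union_sdiff] at h1
  rw [← sPerimeter_congr_ae s h, ← sPerimeter_congr_ae s e]
  refine hm.le _ ((hF.inter hΩ').union (hm.nullMeasurableSet.diff hΩ')) ?_
  ext x; simp only [Set.mem_sdiff, Set.mem_union, Set.mem_inter_iff]; tauto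

/-! ### An almost invariant direction. -/

/-- The circle of translation vectors of length `4`. -/
noncomputable def circleVec (θ : ℝ) : Plane := !₂[4 * Real.cos θ, 4 * Real.sin θ]

theorem norm_circleVec (θ : ℝ) : ‖circleVec θ‖ = 4 := by
  rw [circleVec, EuclideanSpace.norm_eq, Fin.sum_univ_two]
  simp only [Real.norm_eq_abs, sq_abs, Matrix.cons_val_zero, Matrix.cons_val_one]
  rw [show (4 * Real.cos θ) ^ 2 + (4 * Real.sin θ) ^ 2 = 4 ^ 2 by
    nlinarith [Real.sin_sq_add_cos_sq θ]]
  exact Real.sqrt_sq (by norm_num)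

theorem continuous_circleVec : Continuous circleVec := by
  unfold circleVec
  refine (PiLp.continuous_toLp 2 _).comp (continuous_pi fun i => ?_)
  fin_cases i <;> simp <;> fun_prop

theorem circleVec_pi : circleVec Real.pi = -circleVec 0 := by
  ext i; fin_cases i <;> simp [circleVec]

section Translate

variable {E : Set Plane}

/-- By dominated convergence: the indicator of the ball at a point `x` is locally constant in the
centre unless `x` lies on the bounding circle, a null set. -/
theorem continuous_measureReal_inter_ball (E : Set Plane) (r : ℝ) :
    Continuous fun w : Plane => volume.real (E ∩ Metric.ball w r) := by
  have e : ∀ w : Plane, volume.real (E ∩ Metric.ball w r) =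
      ∫ x in E, (Metric.ball w r).indicator (fun _ => (1 : ℝ)) x := by
    intro w
    rw [integral_indicator measurableSet_ball, setIntegral_const, smul_eq_mul, mul_one,
      measureReal_restrict_apply measurableSet_ball, Set.inter_comm]
  simp_rw [e]
  rw [continuous_iff_continuousAt]
  intro w₀
  refine continuousAt_of_dominated
    (bound := (Metric.ball w₀ (r + 1)).indicator fun _ => (1 : ℝ)) ?_ ?_ ?_ ?_
  · exact Filter.Eventually.of_forall fun w =>
      (measurable_const.indicator measurableSet_ball).aestronglyMeasurable
  · filter_upwards [Metric.ball_mem_nhds w₀ one_pos] with w hw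
    refine Filter.Eventually.of_forall fun x => ?_
    by_cases hx : x ∈ Metric.ball w r
    · have hx' : x ∈ Metric.ball w₀ (r + 1) := by
        rw [Metric.mem_ball] at *
        linarith [dist_triangle x w w₀]
      simp [Set.indicator_of_mem hx, Set.indicator_of_mem hx']
    · rw [Set.indicator_of_notMem hx, norm_zero]
      exact Set.indicator_nonneg (fun _ _ => zero_le_one) _
  · exact ((integrable_indicator_iff measurableSet_ball).2
      (integrableOn_const measure_ball_lt_top.ne)).restrict
  · have hs : ∀ᵐ x ∂(volume : Measure Plane), x ∉ Metric.sphere w₀ r :=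
      measure_eq_zero_iff_ae_notMem.1 (Measure.addHaar_sphere volume w₀ r)
    filter_upwards [ae_restrict_of_ae hs] with x hx
    rw [mem_sphere_iff_norm, ← dist_eq_norm] at hx
    rcases lt_or_gt_of_ne hx with hlt | hgt
    · refine (continuousAt_const (y := (1 : ℝ))).congr ?_
      have : ∀ᶠ w in nhds w₀, dist x w < r :=
        (continuous_const.dist continuous_id).continuousAt.eventually_lt_const hlt
      filter_upwards [this] with w hw
      exact (Set.indicator_of_mem (show x ∈ Metric.ball w r from hw) fun _ => (1 : ℝ)).symm
    · refine (continuousAt_const (y := (0 : ℝ))).congr ?_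
      have : ∀ᶠ w in nhds w₀, r < dist x w :=
        (continuous_const.dist continuous_id).continuousAt.eventually_const_lt hgt
      filter_upwards [this] with w hw
      exact (Set.indicator_of_notMem (fun h : x ∈ Metric.ball w r => lt_asymm hw h)
        fun _ => (1 : ℝ)).symm

theorem measureReal_entering_sub_leaving (hE : MeasurableSet E) (w : Plane) (r : ℝ) :
    volume.real ({x | x ∉ E ∧ x - w ∈ E} ∩ Metric.ball 0 r) -
      volume.real ({x | x ∈ E ∧ x - w ∉ E} ∩ Metric.ball 0 r) =
    volume.real (E ∩ Metric.ball (-w) r) - volume.real (E ∩ Metric.ball 0 r) := by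
  have hEw : MeasurableSet {x : Plane | x - w ∈ E} := measurable_sub_const w hE
  have e1 : volume.real (E ∩ Metric.ball (-w) r) =
      volume.real ({x | x - w ∈ E} ∩ Metric.ball 0 r) := by
    have := (measurePreserving_sub_right (volume : Measure Plane) w).measure_preimage
      (hE.inter measurableSet_ball : MeasurableSet (E ∩ Metric.ball (-w) r)).nullMeasurableSet
    rw [measureReal_def, measureReal_def, ← this]
    congr 2
    ext x
    simp [Metric.mem_ball, dist_eq_norm]
  have e2 := measureReal_inter_add_sdiff (s := {x : Plane | x - w ∈ E} ∩ Metric.ball 0 r) hE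
    (μ := volume) (h := measure_inter_lt_top_of_right_ne_top measure_ball_lt_top.ne |>.ne)
  have e3 := measureReal_inter_add_sdiff (s := E ∩ Metric.ball 0 r) hEw
    (μ := volume) (h := measure_inter_lt_top_of_right_ne_top measure_ball_lt_top.ne |>.ne)
  have s1 : ({x : Plane | x - w ∈ E} ∩ Metric.ball 0 r) ∩ E =
      (E ∩ Metric.ball 0 r) ∩ {x | x - w ∈ E} := by ext x; simp; tauto
  have s2 : ({x : Plane | x - w ∈ E} ∩ Metric.ball 0 r) \ E =
      {x | x ∉ E ∧ x - w ∈ E} ∩ Metric.ball 0 r := by ext x; simp; tauto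
  have s3 : (E ∩ Metric.ball 0 r) \ {x | x - w ∈ E} =
      {x | x ∈ E ∧ x - w ∉ E} ∩ Metric.ball 0 r := by ext x; simp; tauto
  rw [s1, s2] at e2
  rw [s3] at e3
  rw [e1]
  linarith

/-- If `x` is entered under `w`, then `x - w` is left under `-w`. Moving the point by at most 4
enlarges the radius from 10 to 14. -/
theorem volume_entering_le_leaving_neg (hE : MeasurableSet E) {w : Plane} (hw : ‖w‖ ≤ 4) :
    volume ({x | x ∉ E ∧ x - w ∈ E} ∩ Metric.ball 0 10) ≤
      volume ({x | x ∈ E ∧ x - -w ∉ E} ∩ Metric.ball 0 14) := by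
  have hEw : MeasurableSet {x : Plane | x - -w ∈ E} := measurable_sub_const (-w) hE
  have hm : MeasurableSet ({x | x ∈ E ∧ x - -w ∉ E} ∩ Metric.ball 0 14) :=
    (hE.inter hEw.compl).inter measurableSet_ball
  refine le_trans (measure_mono ?_) (((measurePreserving_sub_right
    (volume : Measure Plane) w).measure_preimage hm.nullMeasurableSet).le)
  rintro x ⟨⟨h1, h2⟩, h3⟩
  rw [mem_ball_zero_iff] at h3
  refine ⟨⟨h2, ?_⟩, ?_⟩
  · simpa using h1
  · rw [mem_ball_zero_iff]
    linarith [norm_sub_le x w]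

theorem volume_leaving_le_entering_neg (hE : MeasurableSet E) {w : Plane} (hw : ‖w‖ ≤ 4) :
    volume ({x | x ∈ E ∧ x - w ∉ E} ∩ Metric.ball 0 10) ≤
      volume ({x | x ∉ E ∧ x - -w ∈ E} ∩ Metric.ball 0 14) := by
  simpa using volume_entering_le_leaving_neg hE.compl hw

/-- Some translation of length `4` leaves `E` almost unchanged near the origin. -/
theorem exists_almost_invariant_direction (hE : MeasurableSet E) {η : ENNReal}
    (H : ∀ w : Plane, ‖w‖ ≤ 4 →
      volume ({x | x ∈ E ∧ x - w ∉ E} ∩ Metric.ball 0 14) ≤ η ∨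
      volume ({x | x ∉ E ∧ x - w ∈ E} ∩ Metric.ball 0 14) ≤ η) :
    ∃ w : Plane, ‖w‖ = 4 ∧ volume ({x | x ∈ E ∧ x - w ∉ E} ∩ Metric.ball 0 10) ≤ η ∧
      volume ({x | x ∉ E ∧ x - w ∈ E} ∩ Metric.ball 0 10) ≤ η := by
  set G : ℝ → ℝ := fun θ => volume.real (E ∩ Metric.ball (-circleVec θ) 14) -
    volume.real (E ∩ Metric.ball 0 14) with hG
  have hGc : Continuous G := ((continuous_measureReal_inter_ball E 14).comp
    continuous_circleVec.neg).sub continuous_const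
  have hGe : ∀ θ, volume.real ({x | x ∉ E ∧ x - circleVec θ ∈ E} ∩ Metric.ball 0 14) -
      volume.real ({x | x ∈ E ∧ x - circleVec θ ∉ E} ∩ Metric.ball 0 14) = G θ := fun θ =>
    measureReal_entering_sub_leaving hE (circleVec θ) 14
  have fin : ∀ S : Set Plane, volume (S ∩ Metric.ball 0 14) ≠ ⊤ := fun S =>
    (measure_inter_lt_top_of_right_ne_top measure_ball_lt_top.ne).ne
  have hn := fun θ => H (circleVec θ) (norm_circleVec θ).le
  have hL : ∀ θ, 0 ≤ G θ → volume ({x | x ∈ E ∧ x - circleVec θ ∉ E} ∩ Metric.ball 0 14) ≤ η := by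
    intro θ hθ
    rcases hn θ with h | h
    · exact h
    · refine le_trans ?_ h
      rw [← ENNReal.toReal_le_toReal (fin _) (fin _)]
      have := hGe θ
      simp only [measureReal_def] at this
      linarith
  have hR : ∀ θ, G θ ≤ 0 → volume ({x | x ∉ E ∧ x - circleVec θ ∈ E} ∩ Metric.ball 0 14) ≤ η := by
    intro θ hθ
    rcases hn θ with h | h
    · refine le_trans ?_ h
      rw [← ENNReal.toReal_le_toReal (fin _) (fin _)]
      have := hGe θ
      simp only [measureReal_def] at this
      linarith
    · exact h
  have sub : ∀ S : Set Plane, volume (S ∩ Metric.ball 0 10) ≤ volume (S ∩ Metric.ball 0 14) :=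
    fun S => measure_mono (Set.inter_subset_inter_right _ (Metric.ball_subset_ball (by norm_num)))
  have zero : (∃ θ, G θ = 0) → ∃ w : Plane, ‖w‖ = 4 ∧
      volume ({x | x ∈ E ∧ x - w ∉ E} ∩ Metric.ball 0 10) ≤ η ∧
      volume ({x | x ∉ E ∧ x - w ∈ E} ∩ Metric.ball 0 10) ≤ η := fun ⟨θ, hθ⟩ =>
    ⟨circleVec θ, norm_circleVec θ, (sub _).trans (hL θ hθ.ge), (sub _).trans (hR θ hθ.le)⟩
  -- `G` is the net gain, and its sign tells which crossing mass is small. Opposite signs at the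
  -- antipodal angles `0` and `π` give a zero of `G`, where both are small. Equal signs make the
  -- same crossing small for `w` and `-w`, and the one for `-w` controls the other crossing for `w`.
  rcases le_total 0 (G 0) with h0 | h0 <;> rcases le_total 0 (G Real.pi) with hp | hp
  · refine ⟨circleVec 0, norm_circleVec 0, (sub _).trans (hL 0 h0), ?_⟩
    refine (volume_entering_le_leaving_neg hE (norm_circleVec 0).le).trans ?_
    rw [← circleVec_pi]
    exact hL _ hp
  · obtain ⟨θ, -, hθ⟩ := intermediate_value_Icc' Real.pi_pos.le hGc.continuousOn ⟨hp, h0⟩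
    exact zero ⟨θ, hθ⟩
  · obtain ⟨θ, -, hθ⟩ := intermediate_value_Icc Real.pi_pos.le hGc.continuousOn ⟨h0, hp⟩
    exact zero ⟨θ, hθ⟩
  · refine ⟨circleVec 0, norm_circleVec 0, ?_, (sub _).trans (hR 0 h0)⟩
    refine (volume_leaving_le_entering_neg hE (norm_circleVec 0).le).trans ?_
    rw [← circleVec_pi]
    exact hR _ hp

end Translate

/-! ### Cartesian coordinates and conclusion. -/

theorem rectIntegral_indicator {S : Set (ℝ × ℝ)} (hS : MeasurableSet S) {a b c d : ℝ} (hab : a ≤ b)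
    (hcd : c ≤ d) : rectIntegral (S.indicator fun _ => 1) a b c d =
      volume.real (S ∩ Set.Ioc a b ×ˢ Set.Ioc c d) := by
  have hfin : (volume.prod volume : Measure (ℝ × ℝ)) (Set.Ioc a b ×ˢ Set.Ioc c d) ≠ ⊤ := by
    rw [Measure.prod_prod]
    exact ENNReal.mul_ne_top (by simp) (by simp)
  have hi : IntegrableOn (S.indicator fun _ => (1 : ℝ)) (Set.Ioc a b ×ˢ Set.Ioc c d)
      (volume.prod volume : Measure (ℝ × ℝ)) :=
    integrableOn_of_bounded (measurable_const.indicator hS) 1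
      (fun x => by by_cases h : x ∈ S <;> simp [h]) hfin
  unfold rectIntegral
  simp_rw [intervalIntegral.integral_of_le hab, intervalIntegral.integral_of_le hcd]
  rw [← setIntegral_prod _ hi, integral_indicator hS, setIntegral_const, smul_eq_mul, mul_one,
    measureReal_restrict_apply hS]
  rfl

/-- Cartesian coordinates with respect to an orthonormal basis. -/
noncomputable def cartesian (b : OrthonormalBasis (Fin 2) ℝ Plane) (p : ℝ × ℝ) : Plane :=
  p.1 • b 0 + p.2 • b 1

section Cartesian

variable (b : OrthonormalBasis (Fin 2) ℝ Plane)

theorem cartesian_eq (p : ℝ × ℝ) :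
    cartesian b p = b.repr.symm (WithLp.toLp 2 (MeasurableEquiv.finTwoArrow.symm p)) := by
  rw [← b.sum_repr_symm, Fin.sum_univ_two]
  rfl

theorem measurePreserving_cartesian : MeasurePreserving (cartesian b) := by
  have h := b.measurePreserving_repr_symm.comp ((PiLp.volume_preserving_toLp (Fin 2)).comp
    ((volume_preserving_finTwoArrow ℝ).symm _))
  have e : cartesian b = b.repr.symm ∘ WithLp.toLp 2 ∘ MeasurableEquiv.finTwoArrow.symm :=
    funext (cartesian_eq b)
  rw [e]
  exact h

theorem cartesian_sub (p q : ℝ × ℝ) : cartesian b (p - q) = cartesian b p - cartesian b q := by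
  simp only [cartesian, Prod.fst_sub, Prod.snd_sub, sub_smul]
  abel

theorem norm_cartesian_sq (p : ℝ × ℝ) : ‖cartesian b p‖ ^ 2 = p.1 ^ 2 + p.2 ^ 2 := by
  rw [cartesian_eq, LinearIsometryEquiv.norm_map, EuclideanSpace.norm_sq_eq, Fin.sum_univ_two]
  simp [MeasurableEquiv.finTwoArrow]

theorem inner_cartesian (p : ℝ × ℝ) : inner ℝ (b 1) (cartesian b p) = p.2 := by
  simp [cartesian, inner_add_right, inner_smul_right, b.inner_eq_ite]

end Cartesian

theorem exists_orthonormalBasis_zero_eq {v : Plane} (hv : ‖v‖ = 1) :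
    ∃ b : OrthonormalBasis (Fin 2) ℝ Plane, b 0 = v := by
  have ho : Orthonormal ℝ (({0} : Set (Fin 2)).domRestrict fun _ => v) := by
    refine ⟨fun _ => hv, fun i j hij => absurd (Subsingleton.elim i j) hij⟩
  obtain ⟨b, hb⟩ := ho.exists_orthonormalBasis_extension_of_card_eq (by simp)
  exact ⟨b, hb 0 rfl⟩

/-- A measurable set for which each bounded translation adds or removes little mass near the
origin is close to a halfplane in the unit ball. -/
theorem exists_close_halfspace {E : Set Plane} (hE : MeasurableSet E) {η : ℝ} (hη : 0 ≤ η)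
    (H : ∀ w : Plane, ‖w‖ ≤ 4 →
      volume ({x | x ∈ E ∧ x - w ∉ E} ∩ Metric.ball 0 14) ≤ ENNReal.ofReal η ∨
      volume ({x | x ∉ E ∧ x - w ∈ E} ∩ Metric.ball 0 14) ≤ ENNReal.ofReal η) :
    ∃ h : Set Plane, IsHalfspace h ∧
      volume (symmDiff E h ∩ Metric.ball 0 1) ≤ ENNReal.ofReal (5016 * η) := by
  obtain ⟨w₀, hw₀, hN, hM⟩ := exists_almost_invariant_direction hE H
  -- The first axis is taken along the almost invariant direction, so that `(4, 0)` becomes `w₀`.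
  obtain ⟨b, hb⟩ := exists_orthonormalBasis_zero_eq (v := (1 / 4 : ℝ) • w₀) (by
    rw [norm_smul, hw₀]; norm_num)
  have hmp := measurePreserving_cartesian b
  set S : Set (ℝ × ℝ) := cartesian b ⁻¹' E with hS
  have hSm : MeasurableSet S := hmp.measurable hE
  set f : ℝ × ℝ → ℝ := S.indicator fun _ => 1 with hf
  have hf1 : ∀ {z}, z ∈ S → f z = 1 := fun h => Set.indicator_of_mem h _
  have hf0 : ∀ {z}, z ∉ S → f z = 0 := fun h => Set.indicator_of_notMem h _
  have hfm : Measurable f := measurable_const.indicator hSm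
  have h01 : ∀ z, f z = 0 ∨ f z = 1 := fun z => by
    by_cases h : z ∈ S
    · exact Or.inr (hf1 h)
    · exact Or.inl (hf0 h)
  have hball : ∀ {z : ℝ × ℝ} {r : ℝ}, 0 ≤ r → z.1 ^ 2 + z.2 ^ 2 < r ^ 2 →
      cartesian b z ∈ Metric.ball (0 : Plane) r := by
    intro z r hr h
    rw [mem_ball_zero_iff]
    rw [← norm_cartesian_sq b] at h
    exact lt_of_pow_lt_pow_left₀ 2 hr h
  have hrect : ∀ z ∈ Set.Ioc (-3 : ℝ) 1 ×ˢ Set.Ioc (-5 : ℝ) 1,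
      cartesian b z ∈ Metric.ball (0 : Plane) 10 := by
    rintro z ⟨⟨h1, h2⟩, h3, h4⟩
    exact hball (by norm_num) (by nlinarith)
  have trans : ∀ {T : Set Plane}, MeasurableSet T → ∀ {ε : ENNReal},
      volume (T ∩ Metric.ball 0 10) ≤ ε → ε ≠ ⊤ →
      rectIntegral ((cartesian b ⁻¹' T).indicator fun _ => 1) (-3) 1 (-5) 1 ≤ ε.toReal := by
    intro T hT ε h hε
    rw [rectIntegral_indicator (hmp.measurable hT) (by norm_num) (by norm_num)]
    refine ENNReal.toReal_mono hε (le_trans ?_ h)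
    rw [← hmp.measure_preimage (hT.inter measurableSet_ball).nullMeasurableSet]
    exact measure_mono fun z hz => ⟨hz.1, hrect z hz.2⟩
  have hEw : ∀ w : Plane, MeasurableSet {x : Plane | x - w ∈ E} := fun w =>
    measurable_sub_const w hE
  have eN : ∀ p : ℝ × ℝ, (fun z => f z * (1 - f (z - p))) =
      (cartesian b ⁻¹' {x | x ∈ E ∧ x - cartesian b p ∉ E}).indicator fun _ => 1 := by
    intro p; ext z
    have e : z - p ∈ S ↔ cartesian b z - cartesian b p ∈ E := by
      rw [← cartesian_sub]; rfl
    by_cases h1 : z ∈ S <;> by_cases h2 : z - p ∈ S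
    · rw [Set.indicator_of_notMem fun h => h.2 (e.1 h2), hf1 h2]; ring
    · rw [Set.indicator_of_mem (show z ∈ cartesian b ⁻¹' {x | x ∈ E ∧ x - cartesian b p ∉ E} from
        ⟨h1, mt e.2 h2⟩), hf1 h1, hf0 h2]; ring
    · rw [Set.indicator_of_notMem fun h => h1 h.1, hf0 h1]; ring
    · rw [Set.indicator_of_notMem fun h => h1 h.1, hf0 h1]; ring
  have eM : ∀ p : ℝ × ℝ, (fun z => (1 - f z) * f (z - p)) =
      (cartesian b ⁻¹' {x | x ∉ E ∧ x - cartesian b p ∈ E}).indicator fun _ => 1 := by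
    intro p; ext z
    have e : z - p ∈ S ↔ cartesian b z - cartesian b p ∈ E := by
      rw [← cartesian_sub]; rfl
    by_cases h1 : z ∈ S <;> by_cases h2 : z - p ∈ S
    · rw [Set.indicator_of_notMem fun h => h.1 h1, hf1 h1]; ring
    · rw [Set.indicator_of_notMem fun h => h.1 h1, hf1 h1]; ring
    · rw [Set.indicator_of_mem (show z ∈ cartesian b ⁻¹' {x | x ∉ E ∧ x - cartesian b p ∈ E} from
        ⟨h1, e.1 h2⟩), hf0 h1, hf1 h2]; ring
    · rw [Set.indicator_of_notMem fun h => h2 (e.2 h.2), hf0 h2]; ring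
  have mN : ∀ w : Plane, MeasurableSet {x | x ∈ E ∧ x - w ∉ E} := fun w => hE.inter (hEw w).compl
  have mM : ∀ w : Plane, MeasurableSet {x | x ∉ E ∧ x - w ∈ E} := fun w => hE.compl.inter (hEw w)
  have tN := fun p : ℝ × ℝ => trans (mN (cartesian b p)) (ε := ENNReal.ofReal η)
  have tM := fun p : ℝ × ℝ => trans (mM (cartesian b p)) (ε := ENNReal.ofReal η)
  simp_rw [← eN, ENNReal.toReal_ofReal hη] at tN
  simp_rw [← eM, ENNReal.toReal_ofReal hη] at tM
  have sub : ∀ T : Set Plane, volume (T ∩ Metric.ball 0 10) ≤ volume (T ∩ Metric.ball 0 14) :=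
    fun T => measure_mono (Set.inter_subset_inter_right _ (Metric.ball_subset_ball (by norm_num)))
  have hcross : ∀ p q : ℝ, p ^ 2 + q ^ 2 ≤ 16 →
      rectIntegral (fun z => f z * (1 - f (z - (p, q)))) (-3) 1 (-5) 1 ≤ η ∨
      rectIntegral (fun z => (1 - f z) * f (z - (p, q))) (-3) 1 (-5) 1 ≤ η := by
    intro p q hpq
    have hn : ‖cartesian b (p, q)‖ ≤ 4 := by
      refine le_of_sq_le_sq ?_ (by norm_num)
      rw [norm_cartesian_sq]
      norm_num
      exact hpq
    rcases H _ hn with h | h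
    · exact Or.inl (tN (p, q) ((sub _).trans h) ENNReal.ofReal_ne_top)
    · exact Or.inr (tM (p, q) ((sub _).trans h) ENNReal.ofReal_ne_top)
  have h40 : cartesian b (4, 0) = w₀ := by
    simp [cartesian, hb, smul_smul]
  have hfb := BddMeasurable.of_binary hfm h01
  have hper : rectIntegral (fun z => |f z - f (z - (4, 0))|) (-3) 1 (-5) 1 ≤ 2 * η := by
    have e : (fun z => |f z - f (z - (4, 0))|) =
        fun z => f z * (1 - f (z - (4, 0))) + (1 - f z) * f (z - (4, 0)) := by
      ext z
      rcases h01 z with h | h <;> rcases h01 (z - (4, 0)) with h' | h' <;> simp [h, h']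
    rw [e, rectIntegral_add (hfb.leaving _) (hfb.entering _)]
    have a1 := tN (4, 0) (by rw [h40]; exact hN) ENNReal.ofReal_ne_top
    have a2 := tM (4, 0) (by rw [h40]; exact hM) ENNReal.ofReal_ne_top
    linarith
  obtain ⟨c, hc, hcc⟩ := exists_horizontal_halfplane hfm h01 hcross hper
  have e1f : (fun z => 1 - f z) = Sᶜ.indicator fun _ => 1 := by
    ext z
    by_cases h : z ∈ S
    · rw [hf1 h, Set.indicator_of_notMem (fun h' : z ∈ Sᶜ => h' h), sub_self]
    · rw [hf0 h, Set.indicator_of_mem (show z ∈ Sᶜ from h), sub_zero]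
  have toMeas : ∀ {T : Set (ℝ × ℝ)}, MeasurableSet T → ∀ {c d : ℝ}, c ≤ d →
      rectIntegral (T.indicator fun _ => 1) (-1) 1 c d ≤ 2508 * η →
      volume (T ∩ Set.Ioc (-1) 1 ×ˢ Set.Ioc c d) ≤ ENNReal.ofReal (2508 * η) := by
    intro T hT c d hcd h
    rw [rectIntegral_indicator hT (by norm_num) hcd] at h
    rw [← ENNReal.ofReal_toReal (a := volume (T ∩ Set.Ioc (-1) 1 ×ˢ Set.Ioc c d))]
    · exact ENNReal.ofReal_le_ofReal h
    · refine measure_ne_top_of_subset Set.inter_subset_right ?_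
      rw [Measure.volume_eq_prod, Measure.prod_prod]
      exact ENNReal.mul_ne_top (by simp) (by simp)
  have hsum : ENNReal.ofReal (5016 * η) =
      ENNReal.ofReal (2508 * η) + ENNReal.ofReal (2508 * η) := by
    rw [← ENNReal.ofReal_add (by positivity) (by positivity)]; congr 1; ring
  have hbox : ∀ z : ℝ × ℝ, cartesian b z ∈ Metric.ball (0 : Plane) 1 →
      (-1 < z.1 ∧ z.1 < 1) ∧ -1 < z.2 ∧ z.2 < 1 := by
    intro z hz
    have hz' := mem_ball_zero_iff.1 hz
    have h2 : ‖cartesian b z‖ ^ 2 < 1 ^ 2 := pow_lt_pow_left₀ hz' (norm_nonneg _) two_ne_zero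
    rw [norm_cartesian_sq] at h2
    refine ⟨⟨?_, ?_⟩, ?_, ?_⟩ <;> nlinarith [sq_nonneg z.1, sq_nonneg z.2]
  -- For an upper halfplane, the closed half-space contains the line at height `c` while the
  -- half-open rectangle above `c` omits it.
  have hline : volume {z : ℝ × ℝ | z.2 = c} = 0 := by
    have : {z : ℝ × ℝ | z.2 = c} = Set.univ ×ˢ {c} := by ext z; simp
    rw [this, Measure.volume_eq_prod, Measure.prod_prod]; simp
  have hclosed : ∀ (ν : Plane) (d : ℝ), MeasurableSet {x : Plane | inner ℝ ν x ≤ d} := fun ν d =>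
    (isClosed_le (by fun_prop) continuous_const).measurableSet
  have pull : ∀ h : Set Plane, MeasurableSet h → volume (symmDiff E h ∩ Metric.ball 0 1) =
      volume (cartesian b ⁻¹' (symmDiff E h ∩ Metric.ball 0 1)) := fun h hh =>
    (hmp.measure_preimage ((hE.symmDiff hh).inter measurableSet_ball).nullMeasurableSet).symm
  rcases hcc with ⟨h1, h2⟩ | ⟨h1, h2⟩
  · rw [e1f] at h1
    have m1 := toMeas hSm.compl hc.1 h1
    have m2 := toMeas hSm hc.2 h2
    refine ⟨{x | inner ℝ (b 1) x ≤ c}, ⟨b 1, c, b.norm_eq_one 1, rfl⟩, ?_⟩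
    rw [pull _ (hclosed _ _), hsum]
    refine (measure_mono ?_).trans ((measure_union_le _ _).trans (add_le_add m1 m2))
    rintro z ⟨hz, hzb⟩
    obtain ⟨⟨x1, x2⟩, y1, y2⟩ := hbox z hzb
    rcases hz with ⟨hzE, hzh⟩ | ⟨hzh, hzE⟩
    · rw [Set.mem_ofPred_eq, inner_cartesian, not_le] at hzh
      exact Or.inr ⟨hzE, ⟨x1, x2.le⟩, hzh, y2.le⟩
    · rw [Set.mem_ofPred_eq, inner_cartesian] at hzh
      exact Or.inl ⟨hzE, ⟨x1, x2.le⟩, y1, hzh⟩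
  · rw [e1f] at h2
    have m1 := toMeas hSm hc.1 h1
    have m2 := toMeas hSm.compl hc.2 h2
    refine ⟨{x | inner ℝ (-b 1) x ≤ -c}, ⟨-b 1, -c, by rw [norm_neg]; exact b.norm_eq_one 1, rfl⟩,
      ?_⟩
    rw [pull _ (hclosed _ _), hsum, ← add_zero (ENNReal.ofReal _ + _), ← hline]
    refine (measure_mono ?_).trans ((measure_union_le _ _).trans
      (add_le_add_left ((measure_union_le _ _).trans (add_le_add m1 m2)) _))
    rintro z ⟨hz, hzb⟩
    obtain ⟨⟨x1, x2⟩, y1, y2⟩ := hbox z hzb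
    rcases hz with ⟨hzE, hzh⟩ | ⟨hzh, hzE⟩
    · rw [Set.mem_ofPred_eq, inner_neg_left, inner_cartesian, neg_le_neg_iff, not_le] at hzh
      exact Or.inl (Or.inl ⟨hzE, ⟨x1, x2.le⟩, y1, hzh.le⟩)
    · rw [Set.mem_ofPred_eq, inner_neg_left, inner_cartesian, neg_le_neg_iff] at hzh
      rcases hzh.eq_or_lt with heq | hlt
      · exact Or.inr heq.symm
      · exact Or.inl (Or.inr ⟨hzE, ⟨x1, x2.le⟩, hlt, y2.le⟩)

theorem theorem1p7 (s : ℝ) (hs0 : 0 < s) (hs1 : s < 1 / 2) :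
    ∃ C : ℝ, 0 < C ∧ ∀ R : ℝ, 2 ≤ R → ∀ E : Set (EuclideanSpace ℝ (Fin 2)),
      IsSMinimizer s E (Metric.ball 0 R) →
        ∃ h : Set (EuclideanSpace ℝ (Fin 2)), IsHalfspace h ∧
          volume (symmDiff E h ∩ Metric.ball 0 1) ≤ ENNReal.ofReal (C / R ^ s) := by
  obtain ⟨C, R₀, hC, hR₀, hbound⟩ := exists_crossing_bound hs0 hs1
  set B := volume.real (Metric.ball (0 : Plane) 1) with hB
  have hB0 : 0 ≤ B := measureReal_nonneg
  have hRs0 : 0 < R₀ ^ s := by positivity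
  -- The second summand handles `R ≤ R₀`: there any halfplane works, as the error is at most the
  -- area `B` of the unit disc and `R ^ s ≤ R₀ ^ s`.
  refine ⟨5016 * C + B * R₀ ^ s, by positivity, fun R hR E hmin => ?_⟩
  have hR0 : 0 < R := by linarith
  have hRs : 0 < R ^ s := by positivity
  rcases le_total R₀ R with hle | hle
  · obtain ⟨E', -, hE', hae⟩ := hmin.nullMeasurableSet.exists_measurable_superset_ae_eq
    have hmin' := hmin.congr_ae measurableSet_ball hae.symm
    obtain ⟨h, hh, hv⟩ := exists_close_halfspace hE' (η := C / R ^ s) (by positivity)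
      (hbound R hle E' hE' hmin')
    refine ⟨h, hh, ?_⟩
    have e : (symmDiff E h ∩ Metric.ball 0 1 : Set Plane) =ᵐ[volume]
        (symmDiff E' h ∩ Metric.ball 0 1 : Set Plane) :=
      ae_eq_set_inter (ae_eq_set_symmDiff hae.symm Filter.EventuallyEq.rfl) Filter.EventuallyEq.rfl
    rw [measure_congr e]
    refine hv.trans (ENNReal.ofReal_le_ofReal ?_)
    rw [← mul_div_assoc]
    gcongr
    linarith [mul_nonneg hB0 hRs0.le]
  · obtain ⟨v, hv⟩ := exists_norm_eq (E := Plane) (c := 1) zero_le_one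
    refine ⟨{x | inner ℝ v x ≤ 0}, ⟨v, 0, hv, rfl⟩, ?_⟩
    refine (measure_mono Set.inter_subset_right).trans ?_
    rw [← ENNReal.ofReal_toReal (a := volume (Metric.ball (0 : Plane) 1)) measure_ball_lt_top.ne]
    refine ENNReal.ofReal_le_ofReal ?_
    rw [← measureReal_def, ← hB, le_div_iff₀ hRs]
    have : R ^ s ≤ R₀ ^ s := Real.rpow_le_rpow hR0.le hle hs0.le
    nlinarith
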